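/- Let $P_n(x)$ be the Legendre polynomials, given by $P_0(x)=1$, $P_1(x)=x$ and $(n+1)P_{n+1}(x)=(2n+1)xP_n(x)-nP_{n-1}(x)$ for $n\ge 1$. Let $p$ be an odd prime. For real numbers $x,y$ write $x\equiv y \pmod p$ if $x-y=p(u+v\sqrt 2)$ for some rational numbers $u,v$ whose denominators are not divisible by $p$. (i) If $p\equiv 1\pmod 8$, then there are integers $c,d$ with $p=c^2+2d^2$ and $c\equiv 1\pmod 4$, and for all such $c,d$ $$P_{\frac{p-1}2}(\sqrt 2)\equiv (-1)^{\frac{p-1}8+\frac{c-1}4}\,2c \pmod p.$$ (ii) If $p\equiv 3\pmod 8$, then there are integers $c,d$ with $p=c^2+2d^2$ and $d\equiv 1\pmod 4$, and for all such $c,d$ $$P_{\frac{p-1}2}(\sqrt 2)\equiv -2\sqrt 2\,d \pmod p.$$ (iii) If $p\equiv 5$ or $7\pmod 8$, then $P_{\frac{p-1}2}(\sqrt 2)\equiv 0\pmod p$. -/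

import Mathlib

open Polynomial

/-- The Legendre polynomials `P_n`, given by `P_0 = 1`, `P_1 = X` and
`(n + 1) P_{n+1} = (2 n + 1) X P_n - n P_{n-1}` for `n ≥ 1`. -/
noncomputable def legendrePoly : ℕ → ℚ[X]
  | 0 => 1
  | 1 => X
  | n + 2 => C (1 / ((n : ℚ) + 2)) *
      (C (2 * (n : ℚ) + 3) * X * legendrePoly (n + 1) - C ((n : ℚ) + 1) * legendrePoly n)

/-- Congruence modulo `p` in the ring `ℤ_(p)[√2]` of the real numbers `u + v √2`, where `u` and `v`
are rational numbers whose denominators are prime to `p`: the difference `x - y` is `p` times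
an element of that ring. -/
def SqrtTwoModEq (p : ℕ) (x y : ℝ) : Prop :=
  ∃ u v : ℚ, u.den.Coprime p ∧ v.den.Coprime p ∧
    x - y = (p : ℝ) * ((u : ℝ) + (v : ℝ) * Real.sqrt 2)

/-!
Put `n = (p - 1) / 2` and let `χ` be the quadratic character of `𝔽_p`. Since `-1/2 ≡ n`, the
generating function `(1 - 2 t x + x²) ^ (-1/2)` of the Legendre polynomials is, modulo `p`, the
polynomial `(1 - 2 t x + x²) ^ n` in degrees below `p`. For `t = √2` one rescales `x` by `√2`, and
finds that `√2 ^ n P_n(√2)` is the coefficient of `x ^ n` in `(1 - 4 x + 2 x²) ^ n`, which by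
Euler's criterion is `-S` for the sum `S = ∑ χ(x³ - 4 x² + 2 x)` (`scaledLegendre_half_cast`).
The congruences are therefore a statement about the number of points of `y² = x³ - 4 x² + 2 x`, a
curve with complex multiplication by `ℤ[√-2]`.

If `-2` is not a square modulo `p`, then `S = 0`, because the curve is isogenous to its twist by
`-2` (`curveSum_eq_neg_two_mul`).

If `-2` is a square, `S` is found without the theory of elliptic curves. Up to the factor `χ(2)`, two copies of
`S` make up the sum of the sextic form `(x² + y²) (x⁴ - 6 x² y² + y⁴) = N(z) Re(z⁴)`, `z = x + i y`, over the
projective line (`one_add_sum_sextic`). The form belongs to the family `N(z) Re(a z⁴)`,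
`a ∈ 𝔽_p[i]`. Orthogonality of quadratic characters gives the second moment of the sums
`φ(a)` of this family (`sum_projSexticSum_sq`). Up to sign, `φ(a)` depends only on the class of `a`
modulo `𝔽_p^*` and fourth powers; there are four classes, generated by some `g`, where
`φ(g²) = 0` and `φ(g³) = ± φ(g)`. This yields `4 S² + 2 φ(g)² = 16 p`
(`projSexticSum_one_sq_add`), hence `S = 2 c` with `p = c² + 2 d²`. The sign of `c` comes from a
dihedral group of order `8` that permutes the points of the projective line with nonsquare values
freely (`eight_dvd_card_sextic_neg`), so that `2 S` is known modulo `16` and `c` modulo `4`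
(`exists_curveSum_eq`). Quadratic reciprocity then evaluates the powers of `2` that arise from
`√2 ^ n` (`two_pow_of_one_mod_eight`, `mul_two_pow_of_three_mod_eight`).
-/

/-! ### Sums of the quadratic character and the elliptic sum -/

section CharSums
variable {K : Type*} [Field K] [Fintype K] [DecidableEq K]

/-- The quadratic character is unchanged when the argument is multiplied by a nonzero square. -/
theorem quadraticChar_sq_mul {a : K} (ha : a ≠ 0) (b : K) :
    quadraticChar K (a ^ 2 * b) = quadraticChar K b := by
  rw [map_mul, quadraticChar_sq_one' ha, one_mul]

theorem card_filter_sq_eq (h2 : ringChar K ≠ 2) (a : K) :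
    ((Finset.univ.filter fun x : K => x ^ 2 = a).card : ℤ) = quadraticChar K a + 1 := by
  rw [← quadraticChar_card_sqrts h2 a]
  congr 2
  ext x; simp

/-- Summation over squares. -/
theorem sum_comp_sq (h2 : ringChar K ≠ 2) (h : K → ℤ) :
    ∑ x, h (x ^ 2) = ∑ t, h t * (quadraticChar K t + 1) := by
  rw [← Finset.sum_fiberwise' Finset.univ (fun x : K => x ^ 2) h]
  refine Finset.sum_congr rfl fun t _ => ?_
  rw [Finset.sum_const, ← card_filter_sq_eq h2 t, nsmul_eq_mul, mul_comm]

/-- Summation over the fibres of `x ↦ x + b / x`: the equation `x + b / x = t` has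
discriminant `t² - 4 b`. -/
theorem sum_comp_add_div (h2 : ringChar K ≠ 2) {b : K} (hb : b ≠ 0) (g : K → ℤ) :
    ∑ x ∈ Finset.univ.erase 0, g (x + b / x) =
      ∑ t, g t * (quadraticChar K (t ^ 2 - 4 * b) + 1) := by
  have h20 : (2 : K) ≠ 0 := Ring.two_ne_zero h2
  rw [← Finset.sum_fiberwise' (Finset.univ.erase 0) (fun x : K => x + b / x) g]
  refine Finset.sum_congr rfl fun t _ => ?_
  rw [Finset.sum_const, ← card_filter_sq_eq h2, nsmul_eq_mul, mul_comm]
  congr 2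
  refine Finset.card_bij' (fun x _ => x - b / x) (fun y _ => (t + y) / 2) ?_ ?_ ?_ ?_
  · intro x hx
    simp only [Finset.mem_filter, Finset.mem_erase, Finset.mem_univ, and_true, true_and] at hx ⊢
    obtain ⟨hx, rfl⟩ := hx
    field_simp; ring
  · intro y hy
    simp only [Finset.mem_filter, Finset.mem_erase, Finset.mem_univ, and_true, true_and] at hy ⊢
    have h4 : (t - y) * (t + y) = 2 * 2 * b := by linear_combination -hy
    have : t + y ≠ 0 := by
      intro h; rw [h, mul_zero] at h4
      exact mul_ne_zero (mul_ne_zero h20 h20) hb h4.symm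
    refine ⟨div_ne_zero this h20, ?_⟩
    field_simp
    linear_combination -h4
  · intro x hx
    simp only [Finset.mem_filter, Finset.mem_erase, Finset.mem_univ, and_true] at hx ⊢
    obtain ⟨hx, rfl⟩ := hx
    field_simp; ring
  · intro y hy
    simp only [Finset.mem_filter, Finset.mem_univ, true_and] at hy ⊢
    have h4 : (t - y) * (t + y) = 2 * 2 * b := by linear_combination -hy
    have : t + y ≠ 0 := by
      intro h; rw [h, mul_zero] at h4
      exact mul_ne_zero (mul_ne_zero h20 h20) hb h4.symm
    field_simp
    linear_combination h4

variable (K) in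
/-- Minus the trace of Frobenius of the curve `y² = x³ - 4 x² + 2 x`, which has complex
multiplication by `ℤ[√-2]`. -/
noncomputable def curveSum : ℤ := ∑ x : K, quadraticChar K (x * (x ^ 2 - 4 * x + 2))

/-- Substituting `l x` for `x` in `curveSum`. -/
theorem curveSum_eq_scale {l : K} (hl : l ≠ 0) :
    curveSum K = ∑ x : K, quadraticChar K (l * x * ((l * x) ^ 2 - 4 * (l * x) + 2)) :=
  (Equiv.sum_comp (Equiv.mulLeft₀ l hl)
    fun x : K => quadraticChar K (x * (x ^ 2 - 4 * x + 2))).symm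

/-- The curve is `2`-isogenous to its own twist by `-2`. -/
theorem curveSum_eq_neg_two_mul (h2 : ringChar K ≠ 2) :
    curveSum K = quadraticChar K (-2) * curveSum K := by
  have h20 : (2 : K) ≠ 0 := Ring.two_ne_zero h2
  have h1 : curveSum K = ∑ x ∈ Finset.univ.erase (0 : K), quadraticChar K (x + 2 / x - 4) := by
    rw [curveSum, ← Finset.add_sum_erase _ _ (Finset.mem_univ (0 : K))]
    simp only [zero_mul, quadraticChar_zero, zero_add]
    refine Finset.sum_congr rfl fun x hx => ?_
    have hx : x ≠ 0 := Finset.ne_of_mem_erase hx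
    rw [← quadraticChar_sq_mul hx (x + 2 / x - 4)]
    congr 1; field_simp
    ring
  conv_lhs => rw [h1, sum_comp_add_div h2 h20 (fun t => quadraticChar K (t - 4))]
  simp only [mul_add, mul_one, Finset.sum_add_distrib, ← map_mul]
  have h0 : ∑ x : K, quadraticChar K (x - 4) = 0 :=
    (Equiv.sum_comp (Equiv.subRight (4 : K)) (quadraticChar K)).trans (quadraticChar_sum_zero h2)
  rw [h0, add_zero, curveSum, Finset.mul_sum]
  have hm2 : (-2 : K) ≠ 0 := neg_ne_zero.mpr h20
  rw [← Equiv.sum_comp ((Equiv.mulLeft₀ (-2 : K) hm2).trans (Equiv.addRight 4))]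
  refine Finset.sum_congr rfl fun x _ => ?_
  rw [← map_mul, ← quadraticChar_sq_mul h20 (-2 * _)]
  congr 1
  simp only [Equiv.trans_apply, Equiv.coe_addRight, Equiv.mulLeft₀_apply]
  ring

/-- The sextic sum over the projective line, the point at infinity contributing `1`, splits into
two copies of the elliptic sum. -/
theorem one_add_sum_sextic (h2 : ringChar K ≠ 2) :
    1 + ∑ x : K, quadraticChar K ((x ^ 2 + 1) * (x ^ 4 - 6 * x ^ 2 + 1)) =
      2 * quadraticChar K 2 * curveSum K := by
  have h20 : (2 : K) ≠ 0 := Ring.two_ne_zero h2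
  have e1 : ∑ t : K, quadraticChar K ((t + 1) * (t ^ 2 - 6 * t + 1)) =
      quadraticChar K 2 * curveSum K := by
    rw [curveSum, Finset.mul_sum,
      ← Equiv.sum_comp ((Equiv.mulLeft₀ (2 : K) h20).trans (Equiv.subRight 1))]
    refine Finset.sum_congr rfl fun x _ => ?_
    rw [← map_mul, ← quadraticChar_sq_mul h20 (2 * _)]
    congr 1
    simp only [Equiv.trans_apply, Equiv.subRight_apply, Equiv.mulLeft₀_apply]
    ring
  have e2 : ∑ v : K, quadraticChar K (v * (8 * v ^ 2 - 8 * v + 1)) =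
      quadraticChar K 2 * curveSum K := by
    have h40 : (4 : K) ≠ 0 := by
      rw [show (4 : K) = 2 * 2 by norm_num]; exact mul_ne_zero h20 h20
    rw [curveSum_eq_scale h40, Finset.mul_sum]
    refine Finset.sum_congr rfl fun x _ => ?_
    rw [← map_mul, ← quadraticChar_sq_mul (pow_ne_zero 2 h20) (x * _)]
    congr 1
    ring
  have e3 : 1 + ∑ t : K, quadraticChar K (t * ((t + 1) * (t ^ 2 - 6 * t + 1))) =
      quadraticChar K 2 * curveSum K := by
    rw [← e2, ← Equiv.sum_comp (Equiv.subRight (1 : K)),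
      ← Finset.add_sum_erase _ _ (Finset.mem_univ (0 : K)),
      ← Equiv.sum_comp (Equiv.subLeft (1 : K))
        (fun v => quadraticChar K (v * (8 * v ^ 2 - 8 * v + 1))),
      ← Finset.add_sum_erase _ _ (Finset.mem_univ (0 : K))]
    simp only [Equiv.subRight_apply, Equiv.subLeft_apply, sub_zero]
    have : ∑ x ∈ Finset.univ.erase (0 : K),
        quadraticChar K ((x - 1) * ((x - 1 + 1) * ((x - 1) ^ 2 - 6 * (x - 1) + 1))) =
        ∑ x ∈ Finset.univ.erase (0 : K),
        quadraticChar K ((1 - x) * (8 * (1 - x) ^ 2 - 8 * (1 - x) + 1)) := by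
      refine Finset.sum_bij' (fun x _ => x⁻¹) (fun x _ => x⁻¹) ?_ ?_ ?_ ?_ ?_
      · intro x hx; simpa using hx
      · intro x hx; simpa using hx
      · intro x hx; simp
      · intro x hx; simp
      · intro x hx
        have hx : x ≠ 0 := Finset.ne_of_mem_erase hx
        rw [← quadraticChar_sq_mul (pow_ne_zero 2 hx) ((1 - x⁻¹) * _)]
        congr 1
        field_simp
        ring
    rw [this]
    simp
  have e4 := sum_comp_sq h2 (fun t : K => quadraticChar K ((t + 1) * (t ^ 2 - 6 * t + 1)))
  simp only [mul_add (quadraticChar K _), mul_one (quadraticChar K _), Finset.sum_add_distrib,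
    ← pow_mul, Nat.reduceMul] at e4
  rw [e4, e1]
  have e5 : ∑ t : K, quadraticChar K ((t + 1) * (t ^ 2 - 6 * t + 1)) * quadraticChar K t =
      ∑ t : K, quadraticChar K (t * ((t + 1) * (t ^ 2 - 6 * t + 1))) :=
    Finset.sum_congr rfl fun t _ => by rw [← map_mul, mul_comm t]
  rw [e5]
  linarith

end CharSums

/-! ### The family of sextic forms `N(z) Re(a z⁴)` -/

section GaussSextic
variable {K : Type*} [Field K] [Fintype K] [DecidableEq K]

/-- The ring `K[i]` with `i² = -1`; it is `K × K` when `-1` is a square in `K`. -/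
abbrev GaussRing (K : Type*) [Field K] : Type _ := QuadraticAlgebra K (-1) 0

namespace GaussRing

noncomputable instance : Fintype (GaussRing K) :=
  Fintype.ofEquiv (K × K) (QuadraticAlgebra.equivProd (-1) 0).symm

open QuadraticAlgebra

omit [Fintype K] [DecidableEq K] in
theorem norm_eq (z : GaussRing K) : norm z = z.re ^ 2 + z.im ^ 2 := by
  rw [norm_def]; ring

omit [DecidableEq K] in
theorem sum_eq_sum_sum (f : GaussRing K → ℤ) : ∑ z, f z = ∑ y : K, ∑ x : K, f ⟨x, y⟩ := by
  rw [← Equiv.sum_comp (QuadraticAlgebra.equivProd (-1 : K) 0).symm f, Fintype.sum_prod_type_right]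
  rfl

/-- A function that is constant on punctured lines is summed over the projective line. -/
theorem sum_of_homogeneous (f : GaussRing K → ℤ) (h0 : f 0 = 0)
    (hf : ∀ c : K, c ≠ 0 → ∀ z, f (c • z) = f z) :
    ∑ z, f z = ((Fintype.card K : ℤ) - 1) * (f 1 + ∑ s : K, f ⟨s, 1⟩) := by
  have hcard : ((Finset.univ.erase (0 : K)).card : ℤ) = (Fintype.card K : ℤ) - 1 := by
    rw [Finset.card_erase_of_mem (Finset.mem_univ _), Finset.card_univ, Nat.cast_sub
      Fintype.card_pos, Nat.cast_one]
  rw [sum_eq_sum_sum, ← Finset.add_sum_erase _ _ (Finset.mem_univ (0 : K))]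
  have e1 : ∑ x : K, f ⟨x, 0⟩ = ((Fintype.card K : ℤ) - 1) * f 1 := by
    rw [← Finset.add_sum_erase _ _ (Finset.mem_univ (0 : K)), ← hcard, ← nsmul_eq_mul,
      ← Finset.sum_const]
    have : f ⟨0, 0⟩ = 0 := h0
    rw [this, zero_add]
    refine Finset.sum_congr rfl fun x hx => ?_
    rw [← hf x (Finset.ne_of_mem_erase hx) 1]
    congr 1
    ext <;> simp
  have e2 : ∑ y ∈ Finset.univ.erase (0 : K), ∑ x : K, f ⟨x, y⟩ =
      ((Fintype.card K : ℤ) - 1) * ∑ s : K, f ⟨s, 1⟩ := by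
    rw [← hcard, ← nsmul_eq_mul, ← Finset.sum_const]
    refine Finset.sum_congr rfl fun y hy => ?_
    have hy := Finset.ne_of_mem_erase hy
    rw [← Equiv.sum_comp (Equiv.mulLeft₀ y hy)]
    refine Finset.sum_congr rfl fun s _ => ?_
    rw [← hf y hy ⟨s, 1⟩]
    congr 1
    ext <;> simp
  rw [e1, e2]; ring

omit [DecidableEq K] in
/-- Multiplication by an element of nonzero norm permutes `K[i]`. -/
theorem sum_mul_left {t : GaussRing K} (ht : norm t ≠ 0) (f : GaussRing K → ℤ) :
    ∑ z, f (t * z) = ∑ z, f z := by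
  have hu : IsUnit t := isUnit_iff_norm_isUnit.mpr (isUnit_iff_ne_zero.mpr ht)
  obtain ⟨u, rfl⟩ := hu
  exact Equiv.sum_comp (Units.mulLeft u) f

/-- The character sum of the sextic form `N(z) Re(a z⁴)` over the plane. -/
noncomputable def sexticSum (a : GaussRing K) : ℤ :=
  ∑ z : GaussRing K, quadraticChar K (norm z * (a * z ^ 4).re)

/-- The character sum of the sextic form `N(z) Re(a z⁴)` over the projective line. -/
noncomputable def projSexticSum (a : GaussRing K) : ℤ :=
  quadraticChar K a.re +
    ∑ s : K, quadraticChar K ((s ^ 2 + 1) * (a * (⟨s, 1⟩ : GaussRing K) ^ 4).re)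

theorem sexticSum_eq (a : GaussRing K) :
    sexticSum a = ((Fintype.card K : ℤ) - 1) * projSexticSum a := by
  rw [sexticSum, sum_of_homogeneous]
  · simp [projSexticSum, norm_eq]
  · simp
  · intro c hc z
    rw [← quadraticChar_sq_mul (pow_ne_zero 3 hc) (norm z * _)]
    congr 1
    rw [_root_.smul_pow, mul_smul_comm, re_smul, norm_eq, norm_eq]
    simp only [re_smul, im_smul, smul_eq_mul]
    ring

theorem sexticSum_mul_pow_four (a : GaussRing K) {t : GaussRing K} (ht : norm t ≠ 0) :
    sexticSum (a * t ^ 4) = quadraticChar K (norm t) * sexticSum a := by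
  rw [sexticSum, sexticSum,
    ← sum_mul_left ht fun z => quadraticChar K (norm z * (a * z ^ 4).re), Finset.mul_sum]
  refine Finset.sum_congr rfl fun z _ => ?_
  rw [← map_mul, ← quadraticChar_sq_mul ht (norm z * _)]
  congr 1
  rw [map_mul, mul_pow, ← mul_assoc a]
  ring

theorem sexticSum_smul (c : K) (a : GaussRing K) :
    sexticSum (c • a) = quadraticChar K c * sexticSum a := by
  rw [sexticSum, sexticSum, Finset.mul_sum]
  refine Finset.sum_congr rfl fun z _ => ?_
  rw [← map_mul, smul_mul_assoc, re_smul, smul_eq_mul]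
  congr 1
  ring

theorem sexticSum_star (a : GaussRing K) : sexticSum (star a) = sexticSum a := by
  rw [sexticSum, sexticSum, ← Equiv.sum_comp (starAddEquiv (R := GaussRing K)).toEquiv]
  refine Finset.sum_congr rfl fun z _ => ?_
  change quadraticChar K (norm (star z) * (star a * star z ^ 4).re) = _
  rw [QuadraticAlgebra.norm_star, ← star_pow, ← star_mul', re_star]
  simp

/-- If `a` is a zero divisor, then `a = a t⁴` for some `t` with nonsquare norm. -/
theorem sexticSum_eq_zero (h2 : ringChar K ≠ 2) {a : GaussRing K} (ha : norm a = 0) :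
    sexticSum a = 0 := by
  by_cases hre : a.re = 0
  · have him : a.im = 0 := by
      rw [norm_eq, hre] at ha
      simpa using ha
    have : a = 0 := by ext <;> simp [hre, him]
    simp [this, sexticSum]
  · obtain ⟨n, hn⟩ := quadraticChar_exists_neg_one h2
    have h20 : (2 : K) ≠ 0 := Ring.two_ne_zero h2
    set t : GaussRing K := 1 + ((n - 1) / (2 * a.re)) • star a with ht
    have hat : a * t = a := by
      have h : a * star a = 0 := by
        rw [← algebraMap_norm_eq_mul_star, ha, map_zero]
      rw [ht, mul_add, mul_one, mul_smul_comm, h, smul_zero, add_zero]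
    have hN : norm t = n := by
      have : a.im ^ 2 = - a.re ^ 2 := by rw [norm_eq] at ha; linear_combination ha
      rw [norm_eq, ht]
      simp only [re_add, im_add, re_smul, im_smul, re_star, im_star, re_one, im_one, smul_eq_mul,
        zero_mul, add_zero, zero_add, mul_neg, neg_sq, mul_pow, this]
      field_simp
      ring
    have hn0 : n ≠ 0 := by rintro rfl; simp at hn
    have h := sexticSum_mul_pow_four a (t := t) (by rwa [hN])
    have hat4 : a * t ^ 4 = a := by
      rw [show a * t ^ 4 = a * t * t * t * t by ring, hat, hat, hat, hat]
    rw [hat4, hN, hn] at h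
    linarith

/-- Orthogonality of the functions `a ↦ χ(Re(a u))`. -/
theorem sum_char_re_mul (h2 : ringChar K ≠ 2) (u : GaussRing K) :
    ∑ a : GaussRing K, quadraticChar K a.re * quadraticChar K (a * u).re =
      if u.im = 0 then (Fintype.card K : ℤ) * (Fintype.card K - 1) * quadraticChar K u.re
      else 0 := by
  rw [sum_eq_sum_sum, Finset.sum_comm]
  split_ifs with hu
  · have hsum : ∑ x : K, quadraticChar K (x ^ 2) = (Fintype.card K : ℤ) - 1 := by
      rw [← Finset.add_sum_erase _ _ (Finset.mem_univ (0 : K)), Finset.sum_congr rfl fun x hx =>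
        quadraticChar_sq_one' (Finset.ne_of_mem_erase hx)]
      rw [Finset.sum_const, Finset.card_erase_of_mem (Finset.mem_univ _), Finset.card_univ]
      simp [Nat.cast_sub Fintype.card_pos]
    rw [← hsum, Finset.mul_sum, Finset.sum_mul]
    refine Finset.sum_congr rfl fun x _ => ?_
    rw [Finset.sum_congr rfl (g := fun _ => quadraticChar K (x ^ 2) * quadraticChar K u.re),
      Finset.sum_const, Finset.card_univ, nsmul_eq_mul, mul_assoc]
    intro y _
    rw [← map_mul, ← map_mul, re_mul, hu]
    congr 1
    simp only
    ring
  · refine Finset.sum_eq_zero fun x _ => ?_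
    change ∑ y : K, quadraticChar K x * _ = 0
    rw [← Finset.mul_sum]
    have : ∑ y : K, quadraticChar K ((⟨x, y⟩ : GaussRing K) * u).re = 0 := by
      refine Eq.trans (Finset.sum_congr rfl fun y _ => ?_)
        ((Equiv.sum_comp ((Equiv.mulLeft₀ (-u.im) (neg_ne_zero.mpr hu)).trans
          (Equiv.addRight (x * u.re))) (quadraticChar K)).trans (quadraticChar_sum_zero h2))
      congr 1
      rw [re_mul]
      simp only [Equiv.trans_apply, Equiv.coe_addRight, Equiv.mulLeft₀_apply]
      ring
    rw [this, mul_zero]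

omit [Fintype K] [DecidableEq K] in
theorem re_pow_four (z : GaussRing K) :
    (z ^ 4).re = z.re ^ 4 - 6 * z.re ^ 2 * z.im ^ 2 + z.im ^ 4 := by
  rw [show z ^ 4 = z * z * (z * z) by ring]
  simp only [re_mul, im_mul]; ring

omit [Fintype K] [DecidableEq K] in
theorem im_pow_four (z : GaussRing K) :
    (z ^ 4).im = 4 * (z.re * z.im * (z.re ^ 2 - z.im ^ 2)) := by
  rw [show z ^ 4 = z * z * (z * z) by ring]
  simp only [re_mul, im_mul]; ring

/-- The points `z` of the projective line with `z⁴` real are `0, ∞, ±1`; at all of them the sextic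
form is a nonzero square as soon as `-2` is a square. -/
theorem sum_char_norm_pow_four (h2 : ringChar K ≠ 2) (hm2 : quadraticChar K (-2) = 1) :
    ∑ z : GaussRing K, (if (z ^ 4).im = 0 then quadraticChar K (norm z * (z ^ 4).re) else 0) =
      ((Fintype.card K : ℤ) - 1) * 4 := by
  have h20 : (2 : K) ≠ 0 := Ring.two_ne_zero h2
  rw [sum_of_homogeneous]
  · congr 1
    have hs : ∀ s : K, ((⟨s, 1⟩ : GaussRing K) ^ 4).im = 0 ↔ s ∈ ({0, 1, -1} : Finset K) := by
      intro s
      rw [im_pow_four]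
      simp only [Finset.mem_insert, Finset.mem_singleton, mul_one]
      have h4 : (4 : K) ≠ 0 := by
        rw [show (4 : K) = 2 * 2 by norm_num]; exact mul_ne_zero h20 h20
      rw [mul_eq_zero, or_iff_right h4, mul_eq_zero, one_pow, sub_eq_zero, sq_eq_one_iff]
    have h8 : quadraticChar K (2 * -4) = 1 := by
      rw [← hm2, ← quadraticChar_sq_mul h20 (-2)]; congr 1; ring
    have h11 : (1 : K) ≠ -1 := fun h => h20 (by linear_combination h)
    simp only [hs]
    rw [← Finset.sum_filter, Finset.filter_mem_eq_inter, Finset.univ_inter, Finset.sum_insert,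
      Finset.sum_insert, Finset.sum_singleton]
    · have e0 : norm (⟨0, 1⟩ : GaussRing K) * ((⟨0, 1⟩ : GaussRing K) ^ 4).re = 1 := by
        simp only [norm_eq, re_pow_four]; ring
      have e1 : norm (⟨1, 1⟩ : GaussRing K) * ((⟨1, 1⟩ : GaussRing K) ^ 4).re = 2 * -4 := by
        simp only [norm_eq, re_pow_four]; ring
      have e2 : norm (⟨-1, 1⟩ : GaussRing K) * ((⟨-1, 1⟩ : GaussRing K) ^ 4).re = 2 * -4 := by
        simp only [norm_eq, re_pow_four]; ring
      rw [e0, e1, e2, h8]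
      simp
    · simpa using h11
    · simp
  · simp
  · intro c hc z
    have h : ((c • z) ^ 4).im = 0 ↔ (z ^ 4).im = 0 := by
      rw [_root_.smul_pow, im_smul, smul_eq_mul, mul_eq_zero, or_iff_right (pow_ne_zero 4 hc)]
    simp only [h]
    split_ifs
    · rw [← quadraticChar_sq_mul (pow_ne_zero 3 hc) (norm z * _)]
      congr 1
      rw [_root_.smul_pow, re_smul, norm_eq, norm_eq]
      simp only [re_smul, im_smul, smul_eq_mul]
      ring
    · rfl

variable (K) in
/-- The elements of `K[i]` of nonzero norm, that is, its units. -/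
noncomputable def unitSet : Finset (GaussRing K) := Finset.univ.filter fun z => norm z ≠ 0

theorem mem_unitSet {z : GaussRing K} : z ∈ unitSet K ↔ norm z ≠ 0 := by
  simp [unitSet]

/-- The second moment of the sextic sums over all twists. -/
theorem sum_sexticSum_sq (h2 : ringChar K ≠ 2) (hm2 : quadraticChar K (-2) = 1) :
    ∑ a : GaussRing K, sexticSum a ^ 2 =
      4 * Fintype.card K * ((Fintype.card K : ℤ) - 1) ^ 2 * (unitSet K).card := by
  have e1 : ∑ a : GaussRing K, sexticSum a * quadraticChar K a.re =
      4 * Fintype.card K * ((Fintype.card K : ℤ) - 1) ^ 2 := by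
    simp only [sexticSum, Finset.sum_mul]
    rw [Finset.sum_comm]
    have : ∀ z : GaussRing K, ∑ a : GaussRing K,
        quadraticChar K (norm z * (a * z ^ 4).re) * quadraticChar K a.re =
        (Fintype.card K : ℤ) * (Fintype.card K - 1) *
          (if (z ^ 4).im = 0 then quadraticChar K (norm z * (z ^ 4).re) else 0) := by
      intro z
      have h := sum_char_re_mul h2 (z ^ 4)
      calc _ = quadraticChar K (norm z) * ∑ a : GaussRing K,
            quadraticChar K a.re * quadraticChar K (a * z ^ 4).re := by
            rw [Finset.mul_sum]
            refine Finset.sum_congr rfl fun a _ => ?_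
            rw [map_mul]; ring
        _ = _ := by
            rw [h]
            split_ifs
            · rw [map_mul]; ring
            · simp
    simp only [this]
    rw [← Finset.mul_sum, sum_char_norm_pow_four h2 hm2]
    ring
  have e2 : ∀ z : GaussRing K,
      ∑ a : GaussRing K, sexticSum a * quadraticChar K (norm z * (a * z ^ 4).re) =
      if norm z ≠ 0 then 4 * Fintype.card K * ((Fintype.card K : ℤ) - 1) ^ 2 else 0 := by
    intro z
    split_ifs with hz
    · have hz4 : norm (z ^ 4) ≠ 0 := by rw [map_pow]; exact pow_ne_zero 4 hz
      rw [← e1, ← sum_mul_left hz4 fun a => sexticSum a * quadraticChar K a.re]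
      refine Finset.sum_congr rfl fun a _ => ?_
      rw [mul_comm (z ^ 4) a, sexticSum_mul_pow_four a hz, map_mul]
      ring
    · have hz : norm z = 0 := not_not.mp hz
      simp [hz]
  calc ∑ a : GaussRing K, sexticSum a ^ 2
      = ∑ a : GaussRing K, ∑ z : GaussRing K,
          sexticSum a * quadraticChar K (norm z * (a * z ^ 4).re) := by
        refine Finset.sum_congr rfl fun a _ => ?_
        rw [pow_two, ← Finset.mul_sum, sexticSum]
    _ = _ := by
        rw [Finset.sum_comm, Finset.sum_congr rfl fun z _ => e2 z, ← Finset.sum_filter,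
          Finset.sum_const, nsmul_eq_mul, unitSet]
        ring

omit [DecidableEq K] in
theorem card_sub_one_pos : (0 : ℤ) < (Fintype.card K : ℤ) - 1 := by
  have := Fintype.one_lt_card (α := K)
  omega

theorem sum_projSexticSum_sq (h2 : ringChar K ≠ 2) (hm2 : quadraticChar K (-2) = 1) :
    ∑ a ∈ unitSet K, projSexticSum a ^ 2 = 4 * Fintype.card K * (unitSet K).card := by
  have h := sum_sexticSum_sq h2 hm2
  have hq := card_sub_one_pos (K := K)
  have h0 : ∑ a ∈ unitSet K, sexticSum a ^ 2 = ∑ a : GaussRing K, sexticSum a ^ 2 := by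
    refine Finset.sum_subset (Finset.subset_univ _) fun a _ ha => ?_
    rw [mem_unitSet, not_not] at ha
    rw [sexticSum_eq_zero h2 ha]; rfl
  rw [← h0] at h
  simp only [sexticSum_eq, mul_pow] at h
  rw [← Finset.mul_sum] at h
  have hq2 : ((Fintype.card K : ℤ) - 1) ^ 2 ≠ 0 := pow_ne_zero 2 hq.ne'
  refine mul_left_cancel₀ hq2 ?_
  rw [h]; ring

theorem projSexticSum_sq_eq {a b : GaussRing K} (h : sexticSum a ^ 2 = sexticSum b ^ 2) :
    projSexticSum a ^ 2 = projSexticSum b ^ 2 := by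
  have hq := card_sub_one_pos (K := K)
  rw [sexticSum_eq, sexticSum_eq, mul_pow, mul_pow] at h
  exact mul_left_cancel₀ (pow_ne_zero 2 hq.ne') h

/-- The units of `K[i]` form a cyclic group modulo `K^*` and fourth powers, generated by the class
of `g`, and `g` has nonsquare norm. -/
def IsQuarticGenerator (g : GaussRing K) : Prop :=
  quadraticChar K (norm g) = -1 ∧ ∀ a : GaussRing K, norm a ≠ 0 →
    ∃ (j : ℕ) (c : K) (t : GaussRing K), c ≠ 0 ∧ norm t ≠ 0 ∧ a = c • (g ^ j * t ^ 4)

theorem sexticSum_sq_smul_mul_pow_four (b : GaussRing K) {c : K} (hc : c ≠ 0)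
    {t : GaussRing K} (ht : norm t ≠ 0) :
    sexticSum (c • (b * t ^ 4)) ^ 2 = sexticSum b ^ 2 := by
  rw [sexticSum_smul, sexticSum_mul_pow_four _ ht, mul_pow, mul_pow, quadraticChar_sq_one hc,
    quadraticChar_sq_one ht, one_mul, one_mul]

/-- Averaging the second moment over the four classes of twists: the class of `g²` contributes
`0` and those of `g` and `g³`, which are conjugate, contribute equally. -/
theorem projSexticSum_one_sq_add (h2 : ringChar K ≠ 2) (hm2 : quadraticChar K (-2) = 1)
    {g : GaussRing K} (hg : IsQuarticGenerator g) :
    projSexticSum (1 : GaussRing K) ^ 2 + 2 * projSexticSum g ^ 2 = 16 * Fintype.card K := by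
  obtain ⟨hgn, hg⟩ := hg
  have hg0 : norm g ≠ 0 := by
    intro h; rw [h, quadraticChar_zero] at hgn; norm_num at hgn
  have hstar : g * star g = algebraMap K _ (norm g) := (algebraMap_norm_eq_mul_star g).symm
  -- `F j` is the squared sum of the twist by `g ^ j`
  set F : ℕ → ℤ := fun j => projSexticSum (g ^ j) ^ 2 with hF
  have hper : ∀ j, F (j + 4) = F j := fun j => by
    refine projSexticSum_sq_eq ?_
    have := sexticSum_sq_smul_mul_pow_four (g ^ j) one_ne_zero hg0
    rwa [one_smul, ← pow_add] at this
  -- `g²` and its conjugate `N(g)² g² / g⁴` have the same sum, yet `χ(N g) = -1`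
  have h2' : sexticSum (g ^ 2) = 0 := by
    have hs := sexticSum_star (g ^ 2)
    have h4 := sexticSum_mul_pow_four (star (g ^ 2)) hg0
    have e : star (g ^ 2) * g ^ 4 = (norm g ^ 2) • g ^ 2 := by
      rw [star_pow, show star g ^ 2 * g ^ 4 = (g * star g) ^ 2 * g ^ 2 by ring, hstar,
        ← map_pow, ← Algebra.smul_def]
    rw [e, sexticSum_smul, quadraticChar_sq_one' hg0, hs, hgn] at h4
    linarith
  have hF2 : F 2 = 0 := by
    have := sexticSum_eq (g ^ 2)
    rw [h2'] at this
    have hq := card_sub_one_pos (K := K)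
    rcases mul_eq_zero.mp this.symm with h | h
    · exact absurd h hq.ne'
    · simp [hF, h]
  -- `ḡ = N(g) / g` is in the class of `g³`
  have hF3 : F 3 = F 1 := by
    refine projSexticSum_sq_eq ?_
    have e : g ^ 3 * (star g) ^ 4 = (norm g ^ 3) • star g := by
      rw [show g ^ 3 * star g ^ 4 = (g * star g) ^ 3 * star g by ring, hstar,
        ← map_pow, ← Algebra.smul_def]
    have h4 := sexticSum_mul_pow_four (g ^ 3) (t := star g)
      (by rwa [QuadraticAlgebra.norm_star])
    rw [e, sexticSum_smul, sexticSum_star] at h4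
    have h5 := congrArg (· ^ 2) h4
    simp only [mul_pow] at h5
    rw [quadraticChar_sq_one (pow_ne_zero 3 hg0), QuadraticAlgebra.norm_star,
      quadraticChar_sq_one hg0] at h5
    rw [pow_one]; linarith
  have hsum : ∀ j, F j + F (1 + j) + F (2 + j) + F (3 + j) = F 0 + F 1 + F 2 + F 3 := by
    intro j
    induction j with
    | zero => rfl
    | succ j ih =>
      rw [← ih, show 3 + (j + 1) = j + 4 by ring, hper j, show 1 + (j + 1) = 2 + j by ring,
        show 2 + (j + 1) = 3 + j by ring, add_comm j 1]
      ring
  have hval : ∀ k, ∑ a ∈ unitSet K, projSexticSum (g ^ k * a) ^ 2 =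
      4 * Fintype.card K * (unitSet K).card := by
    intro k
    rw [← sum_projSexticSum_sq h2 hm2, unitSet, Finset.sum_filter, Finset.sum_filter]
    have hgk : norm (g ^ k) ≠ 0 := by rw [map_pow]; exact pow_ne_zero k hg0
    rw [← sum_mul_left hgk fun a => if norm a ≠ 0 then projSexticSum a ^ 2 else 0]
    refine Finset.sum_congr rfl fun a _ => ?_
    have : norm (g ^ k * a) ≠ 0 ↔ norm a ≠ 0 := by
      rw [map_mul, mul_ne_zero_iff, and_iff_right hgk]
    simp only [this]
  have hconst : ∀ a ∈ unitSet K, projSexticSum (g ^ 0 * a) ^ 2 + projSexticSum (g ^ 1 * a) ^ 2 +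
      projSexticSum (g ^ 2 * a) ^ 2 + projSexticSum (g ^ 3 * a) ^ 2 = F 0 + F 1 + F 2 + F 3 := by
    intro a ha
    obtain ⟨j, c, t, hc, ht, rfl⟩ := hg a (mem_unitSet.mp ha)
    have hk : ∀ k, projSexticSum (g ^ k * (c • (g ^ j * t ^ 4))) ^ 2 = F (k + j) := fun k => by
      refine projSexticSum_sq_eq ?_
      rw [mul_smul_comm, ← mul_assoc, ← pow_add, sexticSum_sq_smul_mul_pow_four _ hc ht]
    rw [hk, hk, hk, hk, zero_add, hsum]
  have htot := Finset.sum_congr (rfl : unitSet K = unitSet K) hconst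
  simp only [Finset.sum_add_distrib, hval] at htot
  rw [← Finset.sum_add_distrib, ← Finset.sum_add_distrib, ← Finset.sum_add_distrib,
    Finset.sum_const, nsmul_eq_mul, hF2, hF3] at htot
  have hcard : ((unitSet K).card : ℤ) ≠ 0 := by
    have : 1 ∈ unitSet K := by rw [mem_unitSet]; simp
    exact_mod_cast (Finset.card_pos.mpr ⟨1, this⟩).ne'
  have h0 : F 0 = projSexticSum (1 : GaussRing K) ^ 2 := by simp [hF]
  have h1 : F 1 = projSexticSum g ^ 2 := by simp [hF]
  rw [← h0, ← h1]
  refine mul_left_cancel₀ hcard ?_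
  linarith

end GaussRing
end GaussSextic

/-! ### Units of `K[i]` modulo fourth powers and scalars -/

namespace GaussRing
open QuadraticAlgebra

/-- If `-1 = i²` in `K`, then `K[i] = K × K`, and `(h, 1)` is a generator for every primitive
root `h`. -/
theorem exists_isQuarticGenerator_of_sq_eq_neg_one {K : Type*} [Field K] [Fintype K]
    [DecidableEq K] (h2 : ringChar K ≠ 2) {i : K} (hi : i ^ 2 = -1) :
    ∃ g : GaussRing K, IsQuarticGenerator g := by
  have h20 : (2 : K) ≠ 0 := Ring.two_ne_zero h2
  have hi0 : i ≠ 0 := by rintro rfl; simp at hi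
  obtain ⟨h, hh⟩ := IsCyclic.exists_generator (α := Kˣ)
  -- the element with coordinates `(u, v)` in `K × K`
  set e : K → K → GaussRing K := fun u v => ⟨(u + v) / 2, (u - v) / (2 * i)⟩ with he
  have hmul : ∀ u v u' v', e u v * e u' v' = e (u * u') (v * v') := by
    intro u v u' v'
    ext
    · simp only [he, re_mul]
      field_simp
      rw [hi]; ring
    · simp only [he, im_mul]
      field_simp
      ring
  have hone : e 1 1 = 1 := by
    ext <;> simp [he, ← two_mul, h20]
  have hpow : ∀ (u : K) (j : ℕ), e u 1 ^ j = e (u ^ j) 1 := by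
    intro u j
    induction j with
    | zero => simp [hone]
    | succ j ih => rw [pow_succ, ih, hmul, pow_succ, one_mul]
  have hsurj : ∀ a : GaussRing K, a = e (a.re + i * a.im) (a.re - i * a.im) := by
    intro a
    ext
    · simp only [he]; field_simp; ring
    · simp only [he]; field_simp; ring
  have hnorm : ∀ u v, norm (e u v) = u * v := by
    intro u v
    rw [norm_eq]
    simp only [he]
    field_simp
    rw [hi]; ring
  refine ⟨e h 1, ?_, ?_⟩
  · rw [hnorm, mul_one]
    refine (quadraticChar_dichotomy h.ne_zero).resolve_left fun h1 => ?_
    obtain ⟨n, hn⟩ := quadraticChar_exists_neg_one h2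
    have hn0 : n ≠ 0 := by rintro rfl; simp at hn
    obtain ⟨k, hk⟩ := (Submonoid.mem_powers_iff _ _).mp
      ((mem_powers_iff_mem_zpowers (x := h) (y := Units.mk0 n hn0)).mpr (hh _))
    have : n = (h : K) ^ k := by rw [← Units.val_pow_eq_pow_val, hk, Units.val_mk0]
    rw [this, map_pow, h1, one_pow] at hn
    norm_num at hn
  · intro a ha
    rw [hsurj a, hnorm] at ha
    have hu := left_ne_zero_of_mul ha
    have hv := right_ne_zero_of_mul ha
    obtain ⟨k, hk⟩ := (Submonoid.mem_powers_iff _ _).mp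
      ((mem_powers_iff_mem_zpowers (x := h) (y := Units.mk0 _ (div_ne_zero hu hv))).mpr (hh _))
    have hk' : (h : K) ^ k = (a.re + i * a.im) / (a.re - i * a.im) := by
      rw [← Units.val_pow_eq_pow_val, hk, Units.val_mk0]
    refine ⟨k, a.re - i * a.im, 1, hv, by simp, ?_⟩
    rw [one_pow, mul_one, hpow, hk']
    conv_lhs => rw [hsurj a]
    ext
    · simp only [he, re_smul, smul_eq_mul]; field_simp
    · simp only [he, im_smul, smul_eq_mul]; field_simp

/-- If `p ≡ 3 (mod 8)`, then `1 + i` is a generator: `K[i]^* / K^*` has order `p + 1 = 4 m` with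
`m` odd, so modulo fourth powers every `a` may be replaced by a power of `a ^ m`, and the elements
with real fourth power are the real multiples of `1, i, 1 ± i`. -/
theorem exists_isQuarticGenerator_of_three_mod_eight {p : ℕ} [Fact p.Prime] (hp : p % 8 = 3) :
    ∃ g : GaussRing (ZMod p), IsQuarticGenerator g := by
  have hp2 : p ≠ 2 := by rintro rfl; omega
  have h2 : ringChar (ZMod p) ≠ 2 := by rwa [ZMod.ringChar_zmod_n]
  have h20 : (2 : ZMod p) ≠ 0 := Ring.two_ne_zero h2
  set g : GaussRing (ZMod p) := ⟨1, 1⟩ with hg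
  have hgn : norm g = 2 := by rw [norm_eq]; simp only [hg]; norm_num
  have hfrob : ∀ a : GaussRing (ZMod p), a ^ p = star a := by
    intro a
    have : CharP (GaussRing (ZMod p)) p :=
      charP_of_injective_algebraMap (QuadraticAlgebra.algebraMap_injective) p
    have hI : (⟨0, 1⟩ : GaussRing (ZMod p)) ^ 2 = -1 := by
      rw [pow_two]; ext <;> simp
    have hIp : (⟨0, 1⟩ : GaussRing (ZMod p)) ^ p = -⟨0, 1⟩ := by
      have hpe : p = 2 * (2 * (p / 4) + 1) + 1 := by omega
      calc (⟨0, 1⟩ : GaussRing (ZMod p)) ^ p = ⟨0, 1⟩ ^ (2 * (2 * (p / 4) + 1) + 1) :=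
            congrArg _ hpe
        _ = _ := by rw [pow_succ, pow_mul, hI, Odd.neg_one_pow ⟨_, rfl⟩, neg_one_mul]
    have hdec : ∀ b : GaussRing (ZMod p),
        b = algebraMap _ _ b.re + algebraMap _ _ b.im * ⟨0, 1⟩ := by
      intro b; ext <;> simp [QuadraticAlgebra.algebraMap_eq]
    conv_lhs => rw [hdec a]
    rw [add_pow_char, mul_pow, ← map_pow, ← map_pow, ZMod.pow_card, ZMod.pow_card, hIp]
    ext <;> simp [QuadraticAlgebra.algebraMap_eq]
  obtain ⟨m, hm⟩ : ∃ m, p + 1 = 4 * (2 * m + 1) := ⟨p / 8, by omega⟩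
  refine ⟨g, ?_, ?_⟩
  · rw [hgn, quadraticChar_two h2, ZMod.card, ZMod.χ₈_nat_eq_if_mod_eight, if_neg (by omega),
      if_neg (by omega)]
  · -- elements with real fourth power
    have key : ∀ b : GaussRing (ZMod p), norm b ≠ 0 → (b ^ 4).im = 0 →
        ∃ (j : ℕ) (c : ZMod p), c ≠ 0 ∧ b = c • g ^ j := by
      intro b hb hb4
      rw [im_pow_four] at hb4
      have h4 : (4 : ZMod p) ≠ 0 := by
        rw [show (4 : ZMod p) = 2 * 2 by norm_num]; exact mul_ne_zero h20 h20
      have hb4 := (mul_eq_zero.mp hb4).resolve_left h4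
      rw [norm_eq] at hb
      have hg2 : g ^ 2 = ⟨0, 2⟩ := by
        rw [pow_two]; ext <;> simp [hg, one_add_one_eq_two]
      have hg3 : g ^ 3 = ⟨-2, 2⟩ := by
        rw [pow_succ, hg2]; ext <;> simp [hg]
      rcases mul_eq_zero.mp hb4 with h | h
      · rcases mul_eq_zero.mp h with h | h
        · refine ⟨2, b.im / 2, ?_, ?_⟩
          · rw [h] at hb
            exact div_ne_zero (fun h0 => hb (by rw [h0]; ring)) h20
          · rw [hg2]; ext
            · simp [h]
            · simp only [im_smul, smul_eq_mul]; field_simp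
        · refine ⟨0, b.re, ?_, ?_⟩
          · rw [h] at hb
            exact fun h0 => hb (by rw [h0]; ring)
          · ext <;> simp [h]
      · have h' : (b.re - b.im) * (b.re + b.im) = 0 := by linear_combination h
        rcases mul_eq_zero.mp h' with h | h
        · have h := sub_eq_zero.mp h
          refine ⟨1, b.re, ?_, ?_⟩
          · rw [← h] at hb
            exact fun h0 => hb (by rw [h0]; ring)
          · rw [pow_one]; ext <;> simp [hg, h]
        · have h : b.re = -b.im := eq_neg_of_add_eq_zero_left h
          refine ⟨3, b.im / 2, ?_, ?_⟩
          · rw [h] at hb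
            exact div_ne_zero (fun h0 => hb (by rw [h0]; ring)) h20
          · rw [hg3]; ext
            · simp only [re_smul, smul_eq_mul, h]; field_simp
            · simp only [im_smul, smul_eq_mul]; field_simp
    intro a ha
    have hst : a * star a = algebraMap _ _ (norm a) := (algebraMap_norm_eq_mul_star a).symm
    have hN : a ^ (p + 1) = algebraMap _ _ (norm a) := by
      rw [pow_succ, hfrob, mul_comm, hst]
    obtain ⟨j, c, hc, hj⟩ := key (a ^ (2 * m + 1)) (by rw [map_pow]; exact pow_ne_zero _ ha)
      (by rw [← pow_mul, mul_comm, ← hm, hN]; rfl)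
    have hNa : norm a ^ (4 * (m * (m + 1))) ≠ 0 := pow_ne_zero _ ha
    refine ⟨j * (2 * m + 1), c ^ (2 * m + 1) / norm a ^ (4 * (m * (m + 1))),
      star a ^ (m * (m + 1)), div_ne_zero (pow_ne_zero _ hc) hNa, ?_, ?_⟩
    · rw [map_pow, QuadraticAlgebra.norm_star]; exact pow_ne_zero _ ha
    · have e1 : a * a ^ (4 * (m * (m + 1))) = c ^ (2 * m + 1) • g ^ (j * (2 * m + 1)) := by
        rw [pow_mul g, ← _root_.smul_pow, ← hj, ← pow_mul, ← pow_succ']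
        congr 1; ring
      have e2 : norm a ^ (4 * (m * (m + 1))) • a =
          c ^ (2 * m + 1) • (g ^ (j * (2 * m + 1)) * (star a ^ (m * (m + 1))) ^ 4) := by
        rw [← smul_mul_assoc, ← e1, Algebra.smul_def, map_pow, ← hst]
        ring
      rw [div_eq_inv_mul, mul_smul, ← e2, inv_smul_smul₀ hNa]

end GaussRing

/-! ### Dihedral symmetry of the sextic -/

section Dihedral
variable {K : Type*} [Field K]

/-- The dehomogenized sextic form, with roots `±i` and `±1 ± √2`. -/
def sextic (x : K) : K := (x ^ 2 + 1) * (x ^ 4 - 6 * x ^ 2 + 1)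

theorem sextic_neg (x : K) : sextic (-x) = sextic x := by
  simp only [sextic]; ring

theorem sextic_inv {x : K} (hx : x ≠ 0) : sextic x⁻¹ = (x⁻¹ ^ 3) ^ 2 * sextic x := by
  simp only [sextic]; field_simp; ring

theorem sextic_moebius {x : K} (hx : 1 + x ≠ 0) :
    sextic ((1 - x) / (1 + x)) = ((2 / (1 + x) ^ 3) ^ 2) * (-2 * sextic x) := by
  simp only [sextic]; field_simp; ring

/-- The orbit of `x` under `x ↦ -x` and `x ↦ x⁻¹`. -/
def kleinOrbit [DecidableEq K] (x : K) : Finset K := {x, -x, x⁻¹, -x⁻¹}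

theorem mem_kleinOrbit [DecidableEq K] {x y : K} (hx : x ≠ 0) :
    y ∈ kleinOrbit x ↔ y ^ 2 = x ^ 2 ∨ (y * x) ^ 2 = 1 := by
  rw [kleinOrbit, sq_eq_sq_iff_eq_or_eq_neg, sq_eq_one_iff]
  simp only [Finset.mem_insert, Finset.mem_singleton]
  rw [← mul_eq_one_iff_eq_inv₀ hx, ← neg_eq_iff_eq_neg (a := y) (b := x⁻¹),
    ← mul_eq_one_iff_eq_inv₀ hx,
    neg_mul, neg_eq_iff_eq_neg, or_assoc]

theorem card_kleinOrbit [DecidableEq K] (h2 : (2 : K) ≠ 0) {x : K} (hx : x ≠ 0)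
    (h1 : x ^ 2 ≠ 1) (hm1 : x ^ 2 + 1 ≠ 0) : (kleinOrbit x).card = 4 := by
  have e1 : x ≠ -x := fun h => hx (by
    have : 2 * x = 0 := by linear_combination h
    exact (mul_eq_zero.mp this).resolve_left h2)
  have e2 : x ≠ x⁻¹ := fun h => h1 (by rw [← mul_eq_one_iff_eq_inv₀ hx] at h; rw [pow_two, h])
  have e3 : x ≠ -x⁻¹ := fun h => hm1 (by
    rw [← neg_eq_iff_eq_neg, ← mul_eq_one_iff_eq_inv₀ hx] at h; linear_combination -h)
  have e4 : -x ≠ x⁻¹ := fun h => e3 (by rw [← h, neg_neg])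
  have e5 : -x ≠ -x⁻¹ := fun h => e2 (neg_injective h)
  have e6 : x⁻¹ ≠ -x⁻¹ := fun h => e1 (by rw [← inv_neg] at h; exact inv_injective h)
  rw [kleinOrbit, Finset.card_insert_of_notMem, Finset.card_insert_of_notMem,
    Finset.card_insert_of_notMem, Finset.card_singleton]
  · simpa using e6
  · simp [e4, e5]
  · simp [e1, e2, e3]

variable [Fintype K] [DecidableEq K]

/-- The dihedral group of order `8` generated by `x ↦ -x`, `x ↦ x⁻¹` and
`x ↦ (1 - x) / (1 + x)` acts freely on the points where the sextic takes nonsquare values. Its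
orbits are the fibres of `x² (x² - 1)² / (x² + 1)⁴`. -/
theorem eight_dvd_card_sextic_neg (h2 : ringChar K ≠ 2) (hm2 : quadraticChar K (-2) = 1) :
    8 ∣ (Finset.univ.filter fun x : K => quadraticChar K (sextic x) = -1).card := by
  have h20 : (2 : K) ≠ 0 := Ring.two_ne_zero h2
  set s := Finset.univ.filter fun x : K => quadraticChar K (sextic x) = -1 with hs
  have mem_s : ∀ x, x ∈ s ↔ quadraticChar K (sextic x) = -1 := fun x => by simp [hs]
  have hne : ∀ x ∈ s, sextic x ≠ 0 ∧ x ≠ 0 ∧ 1 + x ≠ 0 ∧ 1 - x ≠ 0 := by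
    intro x hx
    rw [mem_s] at hx
    have h8 : quadraticChar K (2 ^ 2 * -2) = 1 := by rw [quadraticChar_sq_mul h20, hm2]
    refine ⟨?_, ?_, ?_, ?_⟩
    · intro h; rw [h, quadraticChar_zero] at hx; norm_num at hx
    · rintro rfl; simp [sextic] at hx
    · intro h
      have h : x = -1 := by linear_combination h
      have : sextic x = 2 ^ 2 * -2 := by rw [h, sextic]; ring
      rw [this, h8] at hx; norm_num at hx
    · intro h
      have h : x = 1 := by linear_combination -h
      have : sextic x = 2 ^ 2 * -2 := by rw [h, sextic]; ring
      rw [this, h8] at hx; norm_num at hx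
  have klein_s : ∀ x ∈ s, ∀ y ∈ kleinOrbit x, y ∈ s := by
    intro x hx y hy
    have hx0 := (hne x hx).2.1
    rw [mem_s] at hx ⊢
    have hinv : quadraticChar K (sextic x⁻¹) = -1 := by
      rw [sextic_inv hx0, quadraticChar_sq_mul (pow_ne_zero _ (inv_ne_zero hx0)), hx]
    simp only [kleinOrbit, Finset.mem_insert, Finset.mem_singleton] at hy
    rcases hy with rfl | rfl | rfl | rfl
    · exact hx
    · rwa [sextic_neg]
    · exact hinv
    · rwa [sextic_neg]
  have moeb_s : ∀ x ∈ s, (1 - x) / (1 + x) ∈ s := by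
    intro x hx
    have hx1 := (hne x hx).2.2.1
    rw [mem_s] at hx ⊢
    rw [sextic_moebius hx1, quadraticChar_sq_mul (div_ne_zero h20 (pow_ne_zero _ hx1)), map_mul,
      hm2, one_mul, hx]
  set j : K → K := fun x => (x * (x ^ 2 - 1)) ^ 2 / (x ^ 2 + 1) ^ 4 with hj
  rw [Finset.card_eq_sum_card_image j s]
  refine Finset.dvd_sum fun b hb => ?_
  obtain ⟨x, hx, rfl⟩ := Finset.mem_image.mp hb
  obtain ⟨hx0, hx1, hx2, hx3⟩ := hne x hx
  set m := (1 - x) / (1 + x) with hm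
  obtain ⟨hm0, hm1, hm2', hm3⟩ := hne m (moeb_s x hx)
  have hfac : ∀ y ∈ s, j y = j x ↔ y ∈ kleinOrbit x ∪ kleinOrbit m := by
    intro y hy
    obtain ⟨hy0, hy1, hy2, hy3⟩ := hne y hy
    have hxi := left_ne_zero_of_mul hx0
    have hyi := left_ne_zero_of_mul hy0
    rw [Finset.mem_union, mem_kleinOrbit hx1, mem_kleinOrbit hm1]
    have e1 : y ^ 2 = m ^ 2 ↔ (1 + x) ^ 2 * y ^ 2 - (1 - x) ^ 2 = 0 := by
      rw [hm, div_pow, eq_div_iff (pow_ne_zero 2 hx2), sub_eq_zero, mul_comm]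
    have e2 : (y * m) ^ 2 = 1 ↔ (1 - x) ^ 2 * y ^ 2 - (1 + x) ^ 2 = 0 := by
      rw [hm, mul_div_assoc', div_pow, div_eq_one_iff_eq (pow_ne_zero 2 hx2), sub_eq_zero,
        mul_pow, mul_comm]
    rw [e1, e2, ← sub_eq_zero (a := y ^ 2), ← sub_eq_zero (b := (1 : K)), ← mul_eq_zero,
      ← mul_eq_zero, ← mul_eq_zero, hj]
    simp only
    rw [div_eq_div_iff (pow_ne_zero 4 hyi) (pow_ne_zero 4 hxi)]
    constructor
    · intro h; linear_combination -h
    · intro h; linear_combination -h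
  have hfib : (s.filter fun y => j y = j x) = kleinOrbit x ∪ kleinOrbit m := by
    ext y
    rw [Finset.mem_filter]
    constructor
    · rintro ⟨hy, h⟩; exact (hfac y hy).mp h
    · intro h
      have hy : y ∈ s := by
        rcases Finset.mem_union.mp h with h | h
        · exact klein_s x hx y h
        · exact klein_s m (moeb_s x hx) y h
      exact ⟨hy, (hfac y hy).mpr h⟩
  have hsq1 : ∀ z ∈ s, z ^ 2 ≠ 1 := by
    intro z hz h
    obtain ⟨-, -, h1, h1'⟩ := hne z hz
    exact mul_ne_zero h1 h1' (by linear_combination -h)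
  rw [hfib, Finset.card_union_of_disjoint,
    card_kleinOrbit h20 hx1 (hsq1 x hx) (left_ne_zero_of_mul hx0),
    card_kleinOrbit h20 hm1 (hsq1 m (moeb_s x hx)) (left_ne_zero_of_mul hm0)]
  rw [Finset.disjoint_left]
  intro y hyx hym
  -- otherwise `x = ± m` or `x m = ± 1`, and `x` is a root of the sextic
  have hprod : (x ^ 2 - m ^ 2) * ((x * m) ^ 2 - 1) = 0 := by
    rw [mem_kleinOrbit hx1] at hyx
    rw [mem_kleinOrbit hm1] at hym
    rcases hyx with h | h <;> rcases hym with h' | h'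
    · rw [← h, h', sub_self, zero_mul]
    · rw [mul_pow, ← h, ← mul_pow, h', sub_self, mul_zero]
    · rw [mul_pow, ← h', ← mul_pow, mul_comm x y, h, sub_self, mul_zero]
    · have : y ^ 2 * (x ^ 2 - m ^ 2) = 0 := by rw [mul_sub, ← mul_pow, ← mul_pow, h, h', sub_self]
      rw [(mul_eq_zero.mp this).resolve_left, zero_mul]
      intro h0
      rw [mul_pow, h0, zero_mul] at h
      exact zero_ne_one h
  apply hx0
  have : (x ^ 2 - m ^ 2) * ((x * m) ^ 2 - 1) * (1 + x) ^ 4 =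
      (x ^ 2 + 1) * sextic x := by
    rw [hm, sextic]; field_simp; ring
  rw [hprod, zero_mul] at this
  exact (mul_eq_zero.mp this.symm).resolve_left (left_ne_zero_of_mul hx0)

/-- A sum of quadratic characters counts zeros and nonsquare values. -/
theorem sum_quadraticChar_eq (f : K → K) :
    ∑ x, quadraticChar K (f x) = (Fintype.card K : ℤ) -
      (Finset.univ.filter fun x => f x = 0).card -
      2 * (Finset.univ.filter fun x => quadraticChar K (f x) = -1).card := by
  have : ∀ x, quadraticChar K (f x) = 1 - (if f x = 0 then 1 else 0) -
      2 * (if quadraticChar K (f x) = -1 then 1 else 0) := by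
    intro x
    by_cases h : f x = 0
    · simp [h]
    · rcases quadraticChar_dichotomy h with h' | h' <;> simp [h, h']
  rw [Finset.sum_congr rfl fun x _ => this x, Finset.sum_sub_distrib, Finset.sum_sub_distrib,
    ← Finset.mul_sum, Finset.sum_boole, Finset.sum_boole, Finset.sum_const, Finset.card_univ]
  simp

theorem sextic_ne_zero (h2 : ringChar K ≠ 2) (hm1 : quadraticChar K (-1) = -1)
    (hs2 : quadraticChar K 2 = -1) (x : K) : sextic x ≠ 0 := by
  have h20 : (2 : K) ≠ 0 := Ring.two_ne_zero h2
  rw [quadraticChar_neg_one_iff_not_isSquare] at hm1 hs2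
  intro h
  rcases mul_eq_zero.mp h with h | h
  · exact hm1 ⟨x, by linear_combination -h⟩
  · by_cases hx : x = 0
    · rw [hx] at h; simp at h
    · refine hs2 ⟨(x ^ 2 + 1) / (2 * x), ?_⟩
      field_simp
      linear_combination -h

theorem card_sextic_eq_zero (h2 : ringChar K ≠ 2) {i r : K} (hi : i ^ 2 = -1) (hr : r ^ 2 = 2) :
    (Finset.univ.filter fun x : K => sextic x = 0).card = 6 := by
  have h20 : (2 : K) ≠ 0 := Ring.two_ne_zero h2
  have : (Finset.univ.filter fun x : K => sextic x = 0) =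
      {i, -i, 1 + r, 1 - r, -1 + r, -1 - r} := by
    ext x
    simp only [Finset.mem_filter, Finset.mem_univ, true_and, Finset.mem_insert,
      Finset.mem_singleton]
    have : sextic x = (x - i) * ((x - (-i)) * ((x - (1 + r)) * ((x - (1 - r)) *
        ((x - (-1 + r)) * (x - (-1 - r)))))) := by
      have h4 : r ^ 4 = 4 := by rw [show r ^ 4 = (r ^ 2) ^ 2 by ring, hr]; norm_num
      rw [sextic]
      have e1 : (x - i) * (x - (-i)) = x ^ 2 + 1 := by linear_combination -hi
      have e2 : (x - (1 + r)) * (x - (1 - r)) = x ^ 2 - 2 * x - 1 := by linear_combination -hr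
      have e3 : (x - (-1 + r)) * (x - (-1 - r)) = x ^ 2 + 2 * x - 1 := by linear_combination -hr
      rw [e3, ← mul_assoc (x - i), e1, ← mul_assoc (x - (1 + r)), e2]
      ring
    rw [this]
    simp only [mul_eq_zero, sub_eq_zero]
  rw [this]
  have hr0 : r ≠ 0 := by rintro rfl; apply h20; rw [← hr]; ring
  repeat rw [Finset.card_insert_of_notMem]
  · simp
  all_goals
    simp only [Finset.mem_insert, Finset.mem_singleton, not_or]
    grind

end Dihedral

/-! ### The elliptic sum in terms of `p = c² + 2 d²` -/

section TwoSquares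

/-- A prime is represented by `x² + 2 y²` in at most one way, up to signs. -/
theorem sq_eq_sq_of_prime_eq_sq_add_two_mul_sq {p : ℕ} (hp : p.Prime) {c d c' d' : ℤ}
    (h : (p : ℤ) = c ^ 2 + 2 * d ^ 2) (h' : (p : ℤ) = c' ^ 2 + 2 * d' ^ 2) : c' ^ 2 = c ^ 2 := by
  have hp0 : (0 : ℤ) < p := by exact_mod_cast hp.pos
  have hpi : Prime (p : ℤ) := Nat.prime_iff_prime_int.mp hp
  -- `p² = X² + 2 Y²` with `Y` divisible by `p` forces `Y = 0`
  have key : ∀ X Y : ℤ, (p : ℤ) ^ 2 = X ^ 2 + 2 * Y ^ 2 → (p : ℤ) ∣ Y → Y = 0 := by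
    rintro X _ hXY ⟨k, rfl⟩
    by_contra hk
    have hk : k ≠ 0 := right_ne_zero_of_mul hk
    have : 0 < k ^ 2 := by positivity
    nlinarith [sq_nonneg X, mul_le_mul_of_nonneg_left this (sq_nonneg (p : ℤ)), pow_pos hp0 2]
  have fin : ∀ Y : ℤ, Y = 0 → Y * (2 * (c * d') - Y) = c ^ 2 * d' ^ 2 - c' ^ 2 * d ^ 2 →
      c' ^ 2 = c ^ 2 := by
    rintro _ rfl hY
    have h0 : (p : ℤ) * (d' ^ 2 - d ^ 2) = 0 := by
      linear_combination -hY + (d' ^ 2) * h - d ^ 2 * h'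
    have := (mul_eq_zero.mp h0).resolve_left hp0.ne'
    linear_combination h - h' - 2 * this
  have hdvd : (p : ℤ) ∣ (c * d' - c' * d) * (c * d' + c' * d) :=
    ⟨d' ^ 2 - d ^ 2, by linear_combination -(d' ^ 2) * h + d ^ 2 * h'⟩
  rcases hpi.dvd_or_dvd hdvd with hY | hY
  · refine fin _ (key (c * c' + 2 * (d * d')) _ ?_ hY) (by ring)
    rw [pow_two]; nth_rewrite 1 [h]; rw [h']; ring
  · refine fin _ (key (c * c' - 2 * (d * d')) _ ?_ hY) (by ring)
    rw [pow_two]; nth_rewrite 1 [h]; rw [h']; ring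

/-- Descent by powers of two in `S² + Y² / 2 = 4 p`. -/
theorem exists_of_four_mul_sq_add {p S Y : ℤ} (h : 4 * S ^ 2 + 2 * Y ^ 2 = 16 * p) :
    ∃ c d : ℤ, S = 2 * c ∧ p = c ^ 2 + 2 * d ^ 2 := by
  have hY : Even Y := by
    have : Even (Y ^ 2) := ⟨4 * p - S ^ 2, by linarith⟩
    exact (Int.even_pow' two_ne_zero).mp this
  obtain ⟨y, rfl⟩ := hY
  have hS : Even S := by
    have : Even (S ^ 2) := ⟨2 * p - y ^ 2, by linarith⟩
    exact (Int.even_pow' two_ne_zero).mp this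
  obtain ⟨c, rfl⟩ := hS
  have hy : Even y := by
    have : Even (y ^ 2) := ⟨p - c ^ 2, by linarith⟩
    exact (Int.even_pow' two_ne_zero).mp this
  obtain ⟨d, rfl⟩ := hy
  exact ⟨c, d, by ring, by linarith⟩

end TwoSquares

section CurveSum
open GaussRing

theorem projSexticSum_one {K : Type*} [Field K] [Fintype K] [DecidableEq K] :
    projSexticSum (1 : GaussRing K) = 1 + ∑ x : K, quadraticChar K (sextic x) := by
  rw [projSexticSum]
  congr 1
  · rw [QuadraticAlgebra.re_one, map_one]
  · refine Finset.sum_congr rfl fun x _ => ?_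
    rw [one_mul, re_pow_four, sextic]
    congr 1
    simp only; ring

/-- The value of the elliptic sum when `p ≡ 1, 3 (mod 8)`: it is `2 c` with `p = c² + 2 d²`, and
the residue of `c` modulo `4` is known. -/
theorem exists_curveSum_eq {p : ℕ} [Fact p.Prime] (hp : p % 8 = 1 ∨ p % 8 = 3) :
    ∃ c d : ℤ, curveSum (ZMod p) = 2 * c ∧ (p : ℤ) = c ^ 2 + 2 * d ^ 2 ∧
      (4 : ℤ) ∣ c + 1 - 2 * (p / 8 : ℕ) := by
  have hp2 : p ≠ 2 := by rintro rfl; omega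
  have h2 : ringChar (ZMod p) ≠ 2 := by rwa [ZMod.ringChar_zmod_n]
  have hm2 : quadraticChar (ZMod p) (-2) = 1 := by
    rw [quadraticChar_neg_two h2, ZMod.card, ZMod.χ₈'_nat_eq_if_mod_eight, if_neg (by omega),
      if_pos hp]
  have h16 : (quadraticChar (ZMod p) 2) ^ 2 = 1 := quadraticChar_sq_one (Ring.two_ne_zero h2)
  have hX : projSexticSum (1 : GaussRing (ZMod p)) =
      2 * quadraticChar (ZMod p) 2 * curveSum (ZMod p) := by
    rw [projSexticSum_one, ← one_add_sum_sextic h2]; rfl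
  obtain ⟨g, hg⟩ : ∃ g : GaussRing (ZMod p), IsQuarticGenerator g := by
    rcases hp with hp | hp
    · obtain ⟨i, hi⟩ := (ZMod.exists_sq_eq_neg_one_iff (p := p)).mpr (by omega)
      exact exists_isQuarticGenerator_of_sq_eq_neg_one h2 (i := i) (by rw [pow_two, ← hi])
    · exact exists_isQuarticGenerator_of_three_mod_eight hp
  have hmom := projSexticSum_one_sq_add h2 hm2 hg
  rw [hX, mul_pow, mul_pow, h16, ZMod.card] at hmom
  obtain ⟨c, d, hc, hcd⟩ := exists_of_four_mul_sq_add (p := p) (S := curveSum (ZMod p))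
    (Y := projSexticSum g) (by linarith)
  refine ⟨c, d, hc, hcd, ?_⟩
  obtain ⟨k, hk⟩ := eight_dvd_card_sextic_neg h2 hm2
  have hsum := sum_quadraticChar_eq (sextic : ZMod p → ZMod p)
  rw [projSexticSum_one, hsum, ZMod.card, hc, hk] at hX
  rcases hp with hp | hp
  · obtain ⟨i, hi⟩ := (ZMod.exists_sq_eq_neg_one_iff (p := p)).mpr (by omega)
    obtain ⟨r, hr⟩ := (ZMod.exists_sq_eq_two_iff hp2).mpr (Or.inl hp)
    rw [card_sextic_eq_zero h2 (i := i) (r := r) (by rw [pow_two, ← hi]) (by rw [pow_two, ← hr]),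
      quadraticChar_two h2, ZMod.card, ZMod.χ₈_nat_eq_if_mod_eight, if_neg (by omega),
      if_pos (Or.inl hp)] at hX
    push_cast at hX ⊢
    omega
  · have hs2 : quadraticChar (ZMod p) 2 = -1 := by
      rw [quadraticChar_two h2, ZMod.card, ZMod.χ₈_nat_eq_if_mod_eight, if_neg (by omega),
        if_neg (by omega)]
    have hs1 : quadraticChar (ZMod p) (-1) = -1 := by
      rw [quadraticChar_neg_one h2, ZMod.card, ZMod.χ₄_nat_three_mod_four (by omega)]
    have h0 : (Finset.univ.filter fun x : ZMod p => sextic x = 0).card = 0 := by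
      rw [Finset.card_eq_zero, Finset.filter_eq_empty_iff]
      exact fun x _ => sextic_ne_zero h2 hs1 hs2 x
    rw [h0, hs2] at hX
    push_cast at hX ⊢
    omega

end CurveSum

/-! ### Legendre polynomials modulo `p` -/

section Reduction

/-- The integers `m! √2 ^ m P_m(√2)`. -/
def scaledLegendre : ℕ → ℤ
  | 0 => 1
  | 1 => 2
  | m + 2 => 2 * (2 * m + 3) * scaledLegendre (m + 1) - 2 * (m + 1) ^ 2 * scaledLegendre m

theorem aeval_legendrePoly_mul (m : ℕ) :
    aeval (Real.sqrt 2) (legendrePoly m) * (Real.sqrt 2 ^ m * (m.factorial : ℝ)) =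
      scaledLegendre m := by
  have h2 : Real.sqrt 2 ^ 2 = 2 := Real.sq_sqrt (by norm_num)
  induction m using Nat.twoStepInduction with
  | zero => simp [legendrePoly, scaledLegendre]
  | one => simp [legendrePoly, scaledLegendre, ← pow_two]
  | more m ih0 ih1 =>
    rw [legendrePoly, scaledLegendre]
    push_cast
    rw [← ih0, ← ih1]
    simp only [map_mul, map_sub, aeval_C, aeval_X, eq_ratCast, Nat.factorial_succ]
    push_cast
    have hm : (m : ℝ) + 2 ≠ 0 := by positivity
    field_simp
    rw [pow_succ _ (m + 1), pow_succ _ m]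
    linear_combination
      ((2 * m + 3) * (m + 2) * (aeval √2 (legendrePoly (m + 1)) : ℝ) * √2 ^ m * √2 -
      (m + 1) * (m + 2) * (aeval √2 (legendrePoly m) : ℝ) * √2 ^ m) * h2

/-- The coefficients of `(1 - 4 X + 2 X²) ^ N` satisfy a three-term recurrence. -/
theorem coeff_pow_recurrence {R : Type*} [CommRing R] {N : ℕ} (hN : 1 ≤ N) (m : ℕ) :
    ((m : R) + 2) * ((1 - C 4 * X + C 2 * X ^ 2 : R[X]) ^ N).coeff (m + 2) =
      4 * (m + 1 - N) * ((1 - C 4 * X + C 2 * X ^ 2 : R[X]) ^ N).coeff (m + 1) +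
      2 * (2 * N - m) * ((1 - C 4 * X + C 2 * X ^ 2 : R[X]) ^ N).coeff m := by
  set D : R[X] := 1 - C 4 * X + C 2 * X ^ 2 with hD
  have hder : derivative D = C 4 * X - C 4 := by
    rw [hD]
    simp only [derivative_add, derivative_sub, derivative_one, derivative_C_mul, derivative_X,
      derivative_X_pow]
    norm_num
    have : (C 2 * C 2 : R[X]) = C 4 := by rw [← C_mul]; norm_num
    linear_combination X * this
  have h : D * derivative (D ^ N) = C (N : R) * (C 4 * X - C 4) * D ^ N := by
    rw [derivative_pow, hder]
    obtain ⟨k, rfl⟩ := Nat.exists_eq_add_of_le' hN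
    rw [Nat.add_sub_cancel, pow_succ]
    ring
  have e1 : D * derivative (D ^ N) = derivative (D ^ N) - C 4 * (derivative (D ^ N) * X) +
      C 2 * (derivative (D ^ N) * X * X) := by rw [hD]; ring
  have e2 : C (N : R) * (C 4 * X - C 4) * D ^ N = C (4 * N : R) * (D ^ N * X) -
      C (4 * N : R) * D ^ N := by rw [C_mul]; ring
  rw [e1, e2] at h
  have hc := congrArg (fun q => coeff q (m + 1)) h
  simp only [coeff_add, coeff_sub, coeff_C_mul, coeff_mul_X, coeff_derivative] at hc
  cases m with
  | zero =>
    simp only [mul_coeff_zero, coeff_X_zero, mul_zero, coeff_derivative] at hc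
    push_cast at hc ⊢
    norm_num at hc ⊢
    linear_combination hc
  | succ m =>
    simp only [coeff_mul_X, coeff_derivative] at hc
    push_cast at hc ⊢
    linear_combination hc

variable {p : ℕ} [Fact p.Prime]

/-- Modulo `p`, the numbers `√2 ^ m P_m(√2)` are the coefficients of
`(1 - 4 X + 2 X²) ^ ((p - 1) / 2)`: the exponent is `-1/2` modulo `p`, so this is the
generating function of the Legendre polynomials. -/
theorem scaledLegendre_cast (hp2 : p ≠ 2) (m : ℕ) :
    (scaledLegendre m : ZMod p) =
      m.factorial * ((1 - C 4 * X + C 2 * X ^ 2 : (ZMod p)[X]) ^ (p / 2)).coeff m := by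
  have hp := (Fact.out : p.Prime)
  have hodd : p % 2 = 1 := hp.eq_two_or_odd.resolve_left hp2
  have hN : (2 : ZMod p) * (p / 2 : ℕ) = -1 := by
    have : ((2 * (p / 2) + 1 : ℕ) : ZMod p) = 0 := by
      rw [show 2 * (p / 2) + 1 = p by omega, CharP.cast_eq_zero]
    push_cast at this
    linear_combination this
  have hN1 : 1 ≤ p / 2 := by have := hp.two_le; omega
  have h0 : ((1 - C 4 * X + C 2 * X ^ 2 : (ZMod p)[X]) ^ (p / 2)).coeff 0 = 1 := by
    rw [coeff_zero_eq_eval_zero]; simp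
  induction m using Nat.twoStepInduction with
  | zero => rw [h0]; simp [scaledLegendre]
  | one =>
    have hder := congrArg (fun q => coeff q 0)
      (derivative_pow (1 - C 4 * X + C 2 * X ^ 2 : (ZMod p)[X]) (p / 2))
    simp only [coeff_derivative, mul_coeff_zero] at hder
    rw [coeff_zero_eq_eval_zero (_ ^ (p / 2 - 1))] at hder
    simp [coeff_one] at hder
    simp only [scaledLegendre, Nat.factorial_one, Nat.cast_one, one_mul]
    rw [hder]
    push_cast
    linear_combination 2 * hN
  | more m ih0 ih1 =>
    have hrec := coeff_pow_recurrence (R := ZMod p) hN1 m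
    rw [scaledLegendre]
    push_cast
    rw [ih0, ih1, Nat.factorial_succ (m + 1), Nat.factorial_succ m]
    push_cast
    linear_combination (-((m : ZMod p) + 1) * m.factorial) * hrec +
      2 * (m + 1) * m.factorial *
        (((1 - C 4 * X + C 2 * X ^ 2 : (ZMod p)[X]) ^ (p / 2)).coeff (m + 1) -
        ((1 - C 4 * X + C 2 * X ^ 2 : (ZMod p)[X]) ^ (p / 2)).coeff m) * hN

theorem sum_pow_eq_ite {i : ℕ} (hi : i ≠ 0) :
    ∑ x : ZMod p, x ^ i = if p - 1 ∣ i then -1 else 0 := by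
  have h := FiniteField.sum_pow_units (ZMod p) i
  rw [ZMod.card] at h
  rw [← h, ← Finset.add_sum_erase _ _ (Finset.mem_univ (0 : ZMod p)), zero_pow hi, zero_add]
  symm
  refine Finset.sum_bij (fun u _ => (u : ZMod p)) ?_ ?_ ?_ ?_
  · intro u _; simp
  · intro u _ v _ h; exact Units.ext h
  · intro x hx; exact ⟨Units.mk0 x (Finset.ne_of_mem_erase hx), Finset.mem_univ _, rfl⟩
  · intro u _; rfl

/-- The middle coefficient, by summing over `x` with Euler's criterion. -/
theorem coeff_half_eq_neg_curveSum (hp2 : p ≠ 2) :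
    ((1 - C 4 * X + C 2 * X ^ 2 : (ZMod p)[X]) ^ (p / 2)).coeff (p / 2) =
      -(curveSum (ZMod p) : ZMod p) := by
  have hp := (Fact.out : p.Prime)
  have hodd : p % 2 = 1 := hp.eq_two_or_odd.resolve_left hp2
  have hp2' := hp.two_le
  have h2 : ringChar (ZMod p) ≠ 2 := by rwa [ZMod.ringChar_zmod_n]
  have h20 : (2 : ZMod p) ≠ 0 := Ring.two_ne_zero h2
  set D : (ZMod p)[X] := 1 - C 4 * X + C 2 * X ^ 2 with hD
  set n := p / 2 with hn
  have hdeg : (D ^ n).natDegree < 2 * n + 1 := by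
    have h1 : D.natDegree ≤ 2 := by rw [hD]; compute_degree
    have := natDegree_pow_le_of_le n h1
    omega
  have e1 : (curveSum (ZMod p) : ZMod p) = ∑ x : ZMod p, x ^ n * (D ^ n).eval x := by
    rw [curveSum_eq_scale h20]
    push_cast
    refine Finset.sum_congr rfl fun x _ => ?_
    have : 2 * x * ((2 * x) ^ 2 - 4 * (2 * x) + 2) = 2 ^ 2 * (x * D.eval x) := by
      rw [hD]; simp only [eval_add, eval_sub, eval_one, eval_mul, eval_C, eval_X, eval_pow]; ring
    rw [this, quadraticChar_sq_mul h20, quadraticChar_eq_pow_of_char_ne_two' h2, ZMod.card,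
      mul_pow, eval_pow]
  rw [e1]
  have e2 : ∀ x : ZMod p, x ^ n * (D ^ n).eval x =
      ∑ k ∈ Finset.range (2 * n + 1), (D ^ n).coeff k * x ^ (n + k) := by
    intro x
    rw [eval_eq_sum_range' hdeg, Finset.mul_sum]
    refine Finset.sum_congr rfl fun k _ => ?_
    rw [pow_add]; ring
  simp only [e2]
  rw [Finset.sum_comm, Finset.sum_eq_single n]
  · rw [← Finset.mul_sum, sum_pow_eq_ite (by omega), if_pos (by rw [show p - 1 = n + n by omega])]
    ring
  · intro k hk hkn
    rw [Finset.mem_range] at hk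
    rw [← Finset.mul_sum, sum_pow_eq_ite (by omega), if_neg, mul_zero]
    rintro ⟨l, hl⟩
    have hp1 : p - 1 = 2 * n := by omega
    rw [hp1] at hl
    have hn0 : 0 < n := by omega
    have hl1 : l = 1 := by
      have h1 : l < 2 := by by_contra h; nlinarith [Nat.mul_le_mul_left (2 * n) (not_lt.mp h)]
      have h0 : l ≠ 0 := by rintro rfl; omega
      omega
    rw [hl1] at hl
    omega
  · intro h; exact absurd (Finset.mem_range.mpr (by omega)) h

theorem scaledLegendre_half_cast (hp2 : p ≠ 2) :
    (scaledLegendre (p / 2) : ZMod p) = -((p / 2).factorial * (curveSum (ZMod p) : ZMod p)) := by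
  rw [scaledLegendre_cast hp2, coeff_half_eq_neg_curveSum hp2, mul_neg]

end Reduction

/-! ### Residue symbols of `c` and `d` -/

section Symbols

variable {p : ℕ} [Fact p.Prime]

theorem gcd_eq_one_of_prime_eq {c d : ℤ} (h : (p : ℤ) = c ^ 2 + 2 * d ^ 2) : Int.gcd c d = 1 := by
  have hp := (Fact.out : p.Prime)
  by_contra hg
  obtain ⟨q, hq, hqg⟩ := Nat.exists_prime_and_dvd hg
  have hqc : (q : ℤ) ∣ c := (Int.natCast_dvd_natCast.mpr hqg).trans (Int.gcd_dvd_left ..)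
  have hqd : (q : ℤ) ∣ d := (Int.natCast_dvd_natCast.mpr hqg).trans (Int.gcd_dvd_right ..)
  have hdvd : ((q * q : ℕ) : ℤ) ∣ p := by
    rw [h, Nat.cast_mul, ← pow_two]
    exact dvd_add (pow_dvd_pow_of_dvd hqc 2) ((pow_dvd_pow_of_dvd hqd 2).mul_left 2)
  exact hq.not_isUnit ((Nat.squarefree_iff_prime_squarefree.mp hp.squarefree q hq
    (Int.natCast_dvd_natCast.mp hdvd)).elim)

/-- `(p / |c|) = (2 / |c|)` since `p ≡ 2 d²` modulo `c`. -/
theorem jacobiSym_natAbs_left {c d : ℤ} (h : (p : ℤ) = c ^ 2 + 2 * d ^ 2) (hc : c % 2 = 1) :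
    jacobiSym p c.natAbs = ZMod.χ₈ c.natAbs := by
  have hodd : Odd c.natAbs := by rw [Int.natAbs_odd, Int.odd_iff]; exact hc
  have e : (p : ℤ) % c.natAbs = (2 * d ^ 2) % c.natAbs := by
    rw [h]
    apply Int.ModEq.symm
    rw [Int.modEq_iff_dvd, Int.natAbs_dvd]
    exact ⟨c, by ring⟩
  rw [jacobiSym.mod_left, e, ← jacobiSym.mod_left, jacobiSym.mul_left, jacobiSym.at_two hodd,
    jacobiSym.sq_one', mul_one]
  rw [Int.gcd_comm, Int.gcd_def, Int.natAbs_natCast, ← Int.gcd_def]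
  exact gcd_eq_one_of_prime_eq h

/-- `p` is a square modulo every divisor of `d`. -/
theorem jacobiSym_of_dvd_right {c d : ℤ} (h : (p : ℤ) = c ^ 2 + 2 * d ^ 2) {m : ℕ}
    (hm : (m : ℤ) ∣ d) : jacobiSym p m = 1 := by
  have e : (p : ℤ) % m = (c ^ 2) % m := by
    rw [h]
    apply Int.ModEq.symm
    rw [Int.modEq_iff_dvd]
    exact (hm.pow two_ne_zero).mul_left 2 |>.trans ⟨1, by ring⟩
  rw [jacobiSym.mod_left, e, ← jacobiSym.mod_left, jacobiSym.sq_one']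
  have h1 := gcd_eq_one_of_prime_eq h
  rw [← Int.isCoprime_iff_gcd_eq_one] at h1 ⊢
  exact h1.of_isCoprime_of_dvd_right hm

theorem sign_mul_natAbs_legendreSym (a : ℤ) :
    legendreSym p a = (if 0 ≤ a then 1 else jacobiSym (-1) p) * jacobiSym a.natAbs p := by
  rw [jacobiSym.legendreSym.to_jacobiSym]
  split_ifs with ha
  · rw [one_mul, Int.natAbs_of_nonneg ha]
  · rw [← jacobiSym.mul_left]
    congr 1; omega

/-- In the case `p ≡ 1 (mod 8)`, `2` is a quartic residue exactly when `c ≡ ± 1 (mod 8)`. -/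
theorem two_pow_of_one_mod_eight (hp : p % 8 = 1) {c d : ℤ} (h : (p : ℤ) = c ^ 2 + 2 * d ^ 2)
    (hc : c % 2 = 1) : (2 : ZMod p) ^ (2 * (p / 8)) = (ZMod.χ₈ c.natAbs : ℤ) := by
  have hpp := (Fact.out : p.Prime)
  have hpodd : Odd p := Nat.odd_iff.mpr (by omega)
  have hm1 : jacobiSym (-1) p = 1 := by
    rw [jacobiSym.at_neg_one hpodd, ZMod.χ₄_nat_one_mod_four (by omega)]
  have hcl : legendreSym p c = ZMod.χ₈ c.natAbs := by
    have hodd : Odd c.natAbs := by rw [Int.natAbs_odd, Int.odd_iff]; exact hc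
    rw [sign_mul_natAbs_legendreSym, hm1, ite_self, one_mul, ← jacobiSym_natAbs_left h hc,
      jacobiSym.quadratic_reciprocity_one_mod_four (by omega) hodd]
  have hdl : legendreSym p d = 1 := by
    have hd0 : d.natAbs ≠ 0 := by
      rw [Int.natAbs_ne_zero]; rintro rfl
      have : IsSquare (p : ℤ) := ⟨c, by rw [h]; ring⟩
      exact (Nat.prime_iff_prime_int.mp hpp).irreducible.not_isSquare this
    obtain ⟨k, m, hm, hkm⟩ := Nat.exists_eq_two_pow_mul_odd hd0
    have hmd : (m : ℤ) ∣ d := by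
      rw [Int.natCast_dvd, hkm]; exact dvd_mul_left _ _
    rw [sign_mul_natAbs_legendreSym, hm1, ite_self, one_mul, hkm]
    push_cast
    rw [jacobiSym.mul_left, jacobiSym.pow_left, jacobiSym.at_two hpodd,
      ZMod.χ₈_nat_eq_if_mod_eight, if_neg (by omega), if_pos (Or.inl hp), one_pow, one_mul,
      ← jacobiSym.quadratic_reciprocity_one_mod_four (by omega) hm, jacobiSym_of_dvd_right h hmd]
  have h1 := legendreSym.eq_pow p c
  have h2 := legendreSym.eq_pow p d
  have hsq : (c : ZMod p) ^ 2 = -2 * (d : ZMod p) ^ 2 := by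
    have := congrArg (Int.cast : ℤ → ZMod p) h
    push_cast at this
    rw [CharP.cast_eq_zero] at this
    linear_combination -this
  have hn : p / 2 = 2 * (2 * (p / 8)) := by omega
  rw [hn, pow_mul] at h1 h2
  rw [hsq, mul_pow, ← h2, hdl, hcl, Even.neg_pow (even_two_mul _)] at h1
  rw [h1]; simp

/-- In the case `p ≡ 3 (mod 8)`, the power `2 ^ ((p + 1) / 4)` is the square root of `-2`
singled out by the signs of `c` and `d`. -/
theorem mul_two_pow_of_three_mod_eight (hp : p % 8 = 3) {c d : ℤ}
    (h : (p : ℤ) = c ^ 2 + 2 * d ^ 2) (hc : (4 : ℤ) ∣ c + 1 - 2 * (p / 8 : ℕ))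
    (hd : d % 4 = 1) : (c : ZMod p) = d * 2 ^ (2 * (p / 8) + 1) := by
  have hpodd : Odd p := Nat.odd_iff.mpr (by omega)
  have hm1 : jacobiSym (-1) p = -1 := by
    rw [jacobiSym.at_neg_one hpodd, ZMod.χ₄_nat_three_mod_four (by omega)]
  have hc8 : c % 8 = 5 ∨ c % 8 = 7 := by
    obtain ⟨e, he⟩ : ∃ e, d = 4 * e + 1 := ⟨d / 4, by omega⟩
    obtain ⟨b, r, hb, hr0, hr8⟩ : ∃ b r, c = 8 * b + r ∧ 0 ≤ r ∧ r < 8 :=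
      ⟨c / 8, c % 8, by omega, by omega, by omega⟩
    have hpq : (p : ℤ) = 8 * (p / 8 : ℕ) + 3 := by omega
    have hsq : c ^ 2 = 16 * (4 * b ^ 2 + b * r) + r ^ 2 := by rw [hb]; ring
    have hsd : d ^ 2 = 8 * (2 * e ^ 2 + e) + 1 := by rw [he]; ring
    rw [hsq, hsd] at h
    generalize 4 * b ^ 2 + b * r = B at h
    generalize 2 * e ^ 2 + e = E at h
    have : r = 0 ∨ r = 1 ∨ r = 2 ∨ r = 3 ∨ r = 4 ∨ r = 5 ∨ r = 6 ∨ r = 7 := by omega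
    rcases this with rfl | rfl | rfl | rfl | rfl | rfl | rfl | rfl <;> norm_num at h <;> omega
  have hcl : legendreSym p c = -1 := by
    have hodd : Odd c.natAbs := by rw [Int.natAbs_odd, Int.odd_iff]; omega
    have hJ := jacobiSym_natAbs_left h (by omega)
    rw [ZMod.χ₈_nat_eq_if_mod_eight, if_neg (by omega)] at hJ
    rw [sign_mul_natAbs_legendreSym, hm1]
    by_cases h4 : c.natAbs % 4 = 1
    · rw [jacobiSym.quadratic_reciprocity_one_mod_four h4 hpodd, hJ]
      split_ifs <;> first | rfl | omega
    · rw [jacobiSym.quadratic_reciprocity_three_mod_four (by omega) (by omega), hJ]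
      split_ifs <;> first | rfl | omega
  have hdl : legendreSym p d = 1 := by
    have hJ := jacobiSym_of_dvd_right h (m := d.natAbs) (Int.natAbs_dvd.mpr dvd_rfl)
    rw [sign_mul_natAbs_legendreSym, hm1]
    by_cases h4 : d.natAbs % 4 = 1
    · rw [jacobiSym.quadratic_reciprocity_one_mod_four h4 hpodd, hJ, if_pos (by omega), one_mul]
    · rw [jacobiSym.quadratic_reciprocity_three_mod_four (by omega) (by omega), hJ,
        if_neg (by omega)]
      rfl
  have h1 := legendreSym.eq_pow p c
  have h2 := legendreSym.eq_pow p d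
  have hsq : (c : ZMod p) ^ 2 = -2 * (d : ZMod p) ^ 2 := by
    have := congrArg (Int.cast : ℤ → ZMod p) h
    push_cast at this
    rw [CharP.cast_eq_zero] at this
    linear_combination -this
  have hn : p / 2 + 1 = 2 * (2 * (p / 8) + 1) := by omega
  have h1' : (c : ZMod p) ^ (2 * (2 * (p / 8) + 1)) = -c := by
    rw [← hn, pow_succ, ← h1, hcl]; push_cast; ring
  have h2' : (d : ZMod p) ^ (2 * (2 * (p / 8) + 1)) = d := by
    rw [← hn, pow_succ, ← h2, hdl]; push_cast; ring
  rw [pow_mul, hsq, mul_pow, ← pow_mul, h2', Odd.neg_pow ⟨_, rfl⟩] at h1'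
  linear_combination h1'

end Symbols

/-! ### Congruences in `ℤ_(p)[√2]` -/

section Congruence

/-- A real number `x` with `x m = a`, for integers `a ≡ b m` and `m` prime to `p`, is congruent
to `b`. -/
theorem sqrtTwoModEq_of_mul_eq {p : ℕ} {x : ℝ} {a b : ℤ} {m : ℕ} (hp : p.Prime)
    (hm : m.Coprime p) (hx : x * m = a) (hab : ((a - b * m : ℤ) : ZMod p) = 0) :
    SqrtTwoModEq p x b := by
  obtain ⟨k, hk⟩ := (ZMod.intCast_zmod_eq_zero_iff_dvd _ p).mp hab
  have hm0 : (m : ℝ) ≠ 0 := by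
    rintro h
    rw [Nat.cast_eq_zero] at h
    rw [h, Nat.coprime_zero_left] at hm
    exact hp.one_lt.ne' hm
  refine ⟨k / m, 0, ?_, by simp, ?_⟩
  · have : (k / m : ℚ).den ∣ m := by
      have := Rat.den_dvd k m
      rw [Rat.divInt_eq_div] at this
      exact_mod_cast this
    exact hm.coprime_dvd_left this
  · have hk' : (a : ℝ) - b * m = p * k := by exact_mod_cast hk
    push_cast
    field_simp
    linear_combination hx + hk'

theorem sqrtTwoModEq_of_mul_eq_sqrt {p : ℕ} {x : ℝ} {a b : ℤ} {m : ℕ} (hp : p.Prime)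
    (hm : m.Coprime p) (hx : x * m = a * √2) (hab : ((a - b * m : ℤ) : ZMod p) = 0) :
    SqrtTwoModEq p x (b * √2) := by
  obtain ⟨k, hk⟩ := (ZMod.intCast_zmod_eq_zero_iff_dvd _ p).mp hab
  have hm0 : (m : ℝ) ≠ 0 := by
    rintro h
    rw [Nat.cast_eq_zero] at h
    rw [h, Nat.coprime_zero_left] at hm
    exact hp.one_lt.ne' hm
  refine ⟨0, k / m, by simp, ?_, ?_⟩
  · have : (k / m : ℚ).den ∣ m := by
      have := Rat.den_dvd k m
      rw [Rat.divInt_eq_div] at this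
      exact_mod_cast this
    exact hm.coprime_dvd_left this
  · have hk' : (a : ℝ) - b * m = p * k := by exact_mod_cast hk
    push_cast
    field_simp
    linear_combination hx + √2 * hk'

variable {p : ℕ} [Fact p.Prime]

theorem coprime_two_pow_mul_factorial (hp2 : p ≠ 2) (k : ℕ) :
    (2 ^ k * (p / 2).factorial).Coprime p := by
  have hp := (Fact.out : p.Prime)
  refine Nat.Coprime.mul_left (Nat.Coprime.pow_left _ ?_) ?_
  · exact (Nat.coprime_primes Nat.prime_two hp).mpr hp2.symm
  · exact (hp.coprime_factorial_of_lt (Nat.div_lt_self hp.pos one_lt_two)).symm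

/-- For even degree, the Legendre value is congruent to `b` if `-S ≡ 2 ^ ((p - 1) / 4) b`. -/
theorem sqrtTwoModEq_of_even (hp2 : p ≠ 2) {k : ℕ} (hk : p / 2 = 2 * k) {b : ℤ}
    (hb : -(curveSum (ZMod p) : ZMod p) = b * 2 ^ k) :
    SqrtTwoModEq p (aeval (√2) (legendrePoly (p / 2))) b := by
  refine sqrtTwoModEq_of_mul_eq Fact.out (coprime_two_pow_mul_factorial hp2 k)
    (a := scaledLegendre (p / 2)) ?_ ?_
  · rw [← aeval_legendrePoly_mul]
    have : (√2 : ℝ) ^ (p / 2) = 2 ^ k := by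
      rw [hk, pow_mul, Real.sq_sqrt (by norm_num)]
    rw [this]; push_cast; ring
  · push_cast
    rw [scaledLegendre_half_cast hp2]
    linear_combination ((p / 2).factorial : ZMod p) * hb

/-- For odd degree, the Legendre value is congruent to `b √2` if `-S ≡ 2 ^ ((p + 1) / 4) b`. -/
theorem sqrtTwoModEq_of_odd (hp2 : p ≠ 2) {k : ℕ} (hk : p / 2 = 2 * k + 1) {b : ℤ}
    (hb : -(curveSum (ZMod p) : ZMod p) = b * 2 ^ (k + 1)) :
    SqrtTwoModEq p (aeval (√2) (legendrePoly (p / 2))) (b * √2) := by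
  refine sqrtTwoModEq_of_mul_eq_sqrt Fact.out (coprime_two_pow_mul_factorial hp2 (k + 1))
    (a := scaledLegendre (p / 2)) ?_ ?_
  · rw [← aeval_legendrePoly_mul]
    have h2 : (√2 : ℝ) ^ 2 = 2 := Real.sq_sqrt (by norm_num)
    have : (√2 : ℝ) ^ (p / 2) * √2 = 2 ^ (k + 1) := by
      rw [hk, pow_succ, pow_mul, h2, mul_assoc, ← pow_two, h2, pow_succ]
    push_cast
    linear_combination (-(aeval (√2) (legendrePoly (p / 2)) : ℝ) * (p / 2).factorial) * this
  · push_cast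
    rw [scaledLegendre_half_cast hp2]
    linear_combination ((p / 2).factorial : ZMod p) * hb

end Congruence

theorem theorem2p7 (p : ℕ) (hp : p.Prime) (hodd : Odd p) :
    (p ≡ 1 [MOD 8] →
      (∃ c d : ℤ, (p : ℤ) = c ^ 2 + 2 * d ^ 2 ∧ c ≡ 1 [ZMOD 4]) ∧
      ∀ c d : ℤ, (p : ℤ) = c ^ 2 + 2 * d ^ 2 → c ≡ 1 [ZMOD 4] →
        SqrtTwoModEq p (aeval (Real.sqrt 2) (legendrePoly ((p - 1) / 2)))
          ((-1 : ℝ) ^ (((p : ℤ) - 1) / 8 + (c - 1) / 4) * (2 * (c : ℝ)))) ∧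
    (p ≡ 3 [MOD 8] →
      (∃ c d : ℤ, (p : ℤ) = c ^ 2 + 2 * d ^ 2 ∧ d ≡ 1 [ZMOD 4]) ∧
      ∀ c d : ℤ, (p : ℤ) = c ^ 2 + 2 * d ^ 2 → d ≡ 1 [ZMOD 4] →
        SqrtTwoModEq p (aeval (Real.sqrt 2) (legendrePoly ((p - 1) / 2)))
          (-2 * Real.sqrt 2 * (d : ℝ))) ∧
    (p ≡ 5 [MOD 8] ∨ p ≡ 7 [MOD 8] →
      SqrtTwoModEq p (aeval (Real.sqrt 2) (legendrePoly ((p - 1) / 2))) 0) := by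
  have : Fact p.Prime := ⟨hp⟩
  have hp1 : p % 2 = 1 := Nat.odd_iff.mp hodd
  have hp2 : p ≠ 2 := by omega
  have hhalf : (p - 1) / 2 = p / 2 := by omega
  rw [hhalf]
  refine ⟨fun h8 => ?_, fun h8 => ?_, fun h8 => ?_⟩
  · have h8 : p % 8 = 1 := h8
    obtain ⟨c', d', hS, hp', hc'⟩ := exists_curveSum_eq (p := p) (Or.inl h8)
    refine ⟨?_, fun c d hcd hc => ?_⟩
    · rcases (by omega : c' % 4 = 1 ∨ (-c') % 4 = 1) with h | h
      · exact ⟨c', d', hp', h⟩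
      · exact ⟨-c', d', by rw [hp']; ring, h⟩
    · have hc4 : c % 4 = 1 := hc
      have h2 := two_pow_of_one_mod_eight h8 hcd (by omega)
      have hcc := sq_eq_sq_iff_eq_or_eq_neg.mp (sq_eq_sq_of_prime_eq_sq_add_two_mul_sq hp hcd hp')
      -- the sign in the statement, as an integer
      obtain ⟨ε, hε, hεχ⟩ : ∃ ε : ℤ,
          (-1 : ℝ) ^ (((p : ℤ) - 1) / 8 + (c - 1) / 4) = ε ∧
          -c' = ε * c * ZMod.χ₈ c.natAbs := by
        rw [ZMod.χ₈_nat_eq_if_mod_eight, if_neg (by omega)]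
        rcases Int.even_or_odd (((p : ℤ) - 1) / 8 + (c - 1) / 4) with he | he
        · refine ⟨1, by rw [he.neg_one_zpow]; simp, ?_⟩
          obtain ⟨l, hl⟩ := he
          split_ifs <;> omega
        · refine ⟨-1, by rw [he.neg_one_zpow]; simp, ?_⟩
          obtain ⟨l, hl⟩ := he
          split_ifs <;> omega
      have hmain := sqrtTwoModEq_of_even hp2 (k := 2 * (p / 8)) (by omega) (b := ε * (2 * c)) (by
        rw [hS, h2]
        have := congrArg (Int.cast : ℤ → ZMod p) hεχ
        push_cast at this ⊢
        linear_combination 2 * this)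
      rw [hε]
      push_cast at hmain
      exact hmain
  · have h8 : p % 8 = 3 := h8
    obtain ⟨c', d', hS, hp', hc'⟩ := exists_curveSum_eq (p := p) (Or.inr h8)
    refine ⟨?_, fun c d hcd hd => ?_⟩
    · have hd' : d' % 2 = 1 := by
        by_contra h
        obtain ⟨e, rfl⟩ : ∃ e, d' = 2 * e := ⟨d' / 2, by omega⟩
        obtain ⟨b, rfl⟩ : ∃ b, c' = 2 * b + 1 := ⟨c' / 2, by omega⟩
        have : (p : ℤ) = 4 * (b ^ 2 + b + 2 * e ^ 2) + 1 := by rw [hp']; ring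
        omega
      rcases (by omega : d' % 4 = 1 ∨ (-d') % 4 = 1) with h | h
      · exact ⟨c', d', hp', h⟩
      · exact ⟨c', -d', by rw [hp']; ring, h⟩
    · have hcc := sq_eq_sq_of_prime_eq_sq_add_two_mul_sq hp hcd hp'
      have hcd' : (p : ℤ) = c' ^ 2 + 2 * d ^ 2 := by rw [hcc, hcd]
      have h2 := mul_two_pow_of_three_mod_eight h8 hcd' hc' hd
      have hmain := sqrtTwoModEq_of_odd hp2 (k := 2 * (p / 8)) (by omega) (b := -2 * d) (by
        rw [hS]
        push_cast
        rw [h2]; ring)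
      have e : (-2 * √2 * (d : ℝ)) = ((-2 * d : ℤ) : ℝ) * √2 := by push_cast; ring
      rw [e]
      exact hmain
  · have hr : ringChar (ZMod p) ≠ 2 := by rwa [ZMod.ringChar_zmod_n]
    have h8 : p % 8 = 5 ∨ p % 8 = 7 := h8
    have hS : curveSum (ZMod p) = 0 := by
      have h := curveSum_eq_neg_two_mul hr
      rw [quadraticChar_neg_two hr, ZMod.card, ZMod.χ₈'_nat_eq_if_mod_eight, if_neg (by omega),
        if_neg (by omega)] at h
      omega
    rcases Nat.even_or_odd' (p / 2) with ⟨k, hk | hk⟩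
    · have := sqrtTwoModEq_of_even hp2 hk (b := 0) (by rw [hS]; simp)
      simpa using this
    · have := sqrtTwoModEq_of_odd hp2 hk (b := 0) (by rw [hS]; simp)
      simpa using this
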